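/- For $\lambda\in\mathbb C$, $r>0$ let $D(\lambda,r)=\{z:|z-\lambda|<r\}$ and $\mathbb D=D(0,1)$. A *string of beads set* is a set $K=\overline{\mathbb D}\setminus\bigcup_{n\ge1}D(\lambda_n,r_n)$, where $\lambda_n\in\mathbb R$, $r_n>0$, $D(\lambda_n,r_n)\subset\mathbb D$, the closed disks $\overline{D(\lambda_n,r_n)}$ are pairwise disjoint, and $K\cap\mathbb R$ has empty interior in $\mathbb R$ and positive length. Put $\Omega=\operatorname{int}K$, $\Omega_U=\{z\in\Omega:\operatorname{Im}z>0\}$, $\Omega_L=\Omega\setminus\Omega_U$. Let $\partial_iK$ be the inner boundary of $K$, i.e. $\partial K$ minus the union of the boundaries of the components of $\mathbb C\setminus K$ (so $\partial_iK\subset\mathbb R$), and let $l$ be length on $\mathbb R$ restricted to $\partial_iK$. For a finite positive Borel measure $\mu$ on $K$, let $R^2(K,\mu)$ be the closure in $L^2(\mu)$ of $\mathrm{Rat}(K)$, the rational functions with poles off $K$. A point $z$ is a *bounded point evaluation* for $R^2(K,\mu)$ if $|q(z)|\le C\|q\|_{L^2(\mu)}$ for some $C$ and all $q\in\mathrm{Rat}(K)$,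 and an *analytic bounded point evaluation* if it is interior to the set of bounded point evaluations and one constant $C$ serves a whole disk about it. For $f\in R^2(K,\mu)$ and a bounded point evaluation $z$, let $\rho(f)(z)$ be the value at $f$ of the continuous extension of $q\mapsto q(z)$ to $R^2(K,\mu)$. Let $S_\mu$ be multiplication by $z$ on $R^2(K,\mu)$; $S_\mu$ is *irreducible* if $R^2(K,\mu)$ contains no non-trivial characteristic function (if $\chi_A\in R^2(K,\mu)$ for a Borel set $A$, then $\mu(A)=0$ or $\mu(\mathbb C\setminus A)=0$). **Statement.** Let $K$ be a string of beads set with $\pm\frac i2\in\Omega$. Let $\omega_a$ and $\omega_b$ be the harmonic measures of $\Omega_U$ and $\Omega_L$ evaluated at $a=\frac i2$ and $b=-\frac i2$, and let $\omega=\omega_a+\omega_b$. Then every point of $\Omega$ is an analytic bounded point evaluation for $R^2(K,\omega)$, and for every $f\in R^2(K,\omega)$ the following holds for $l$-almost every $\lambda\in\partial_iK$ and every $0<\alpha\le1$: for some $n\ge1$ the cones $$U_n(\lambda,\alpha)=\{z:|\operatorname{Re}(z-\lambda)|<\alpha\operatorname{Im}(z-\lambda)\}\cap D(\lambda,\tfrac1n),\qquad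 L_n(\lambda,\alpha)=\{z:|\operatorname{Re}(z-\lambda)|<-\alpha\operatorname{Im}(z-\lambda)\}\cap D(\lambda,\tfrac1n)$$ are contained in $\Omega$, the non-tangential limits of $\rho(f)$ from the top and from the bottom, $$f_+(\lambda)=\lim_{U_n(\lambda,\alpha)\ni z\to\lambda}\rho(f)(z),\qquad f_-(\lambda)=\lim_{L_n(\lambda,\alpha)\ni z\to\lambda}\rho(f)(z),$$ exist, and $f_+(\lambda)=f_-(\lambda)=f(\lambda)$. Moreover, $S_\omega$ is irreducible. -/

import Mathlib

open MeasureTheory Filter Topology Metric Set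
open scoped ENNReal

noncomputable section

namespace MeanRational

/-! ### String of beads sets -/

/-- `K` is a string of beads set: the closed unit disk with a sequence of open disks removed, the
disks being centred on the real line, contained in the open unit disk and with pairwise disjoint
closures, such that `K ∩ ℝ` has empty interior in `ℝ` and positive length. -/
def IsStringOfBeads (K : Set ℂ) : Prop :=
  ∃ (c r : ℕ → ℝ),
    (∀ n, 0 < r n) ∧
    (∀ n, ball (c n : ℂ) (r n) ⊆ ball 0 1) ∧
    (Pairwise fun i j => Disjoint (closedBall (c i : ℂ) (r i)) (closedBall (c j : ℂ) (r j))) ∧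
    K = closedBall 0 1 \ ⋃ n, ball (c n : ℂ) (r n) ∧
    interior {x : ℝ | (x : ℂ) ∈ K} = ∅ ∧
    0 < volume {x : ℝ | (x : ℂ) ∈ K}

/-- `Ω_U`, the part of `Ω = int K` in the open upper half plane. -/
def upperPart (K : Set ℂ) : Set ℂ := {z ∈ interior K | 0 < z.im}

/-- `Ω_L = Ω \ Ω_U`, where `Ω = int K`. -/
def lowerPart (K : Set ℂ) : Set ℂ := interior K \ upperPart K

/-- The exterior boundary `∂ₑK`: the union of the boundaries of the components of `ℂ \ K`. -/
def outerBoundary (K : Set ℂ) : Set ℂ := ⋃ z ∈ Kᶜ, frontier (connectedComponentIn Kᶜ z)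

/-- The inner boundary `∂ᵢK = ∂K \ ∂ₑK`. -/
def innerBoundary (K : Set ℂ) : Set ℂ := frontier K \ outerBoundary K

/-! ### Harmonic measure -/

/-- `μ` is the harmonic measure of the bounded domain `G` evaluated at `a`: the Borel probability
measure on `∂G` which represents evaluation at `a` for the functions that are continuous on the
closure of `G` and harmonic in `G`. It is unique when the Dirichlet problem is solvable on `G` for
all continuous boundary data, for example when `G` is a Jordan domain. -/
structure IsHarmonicMeasure (G : Set ℂ) (a : ℂ) (μ : Measure ℂ) : Prop where
  isProbabilityMeasure : IsProbabilityMeasure μ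
  measure_compl_frontier : μ (frontier G)ᶜ = 0
  integral_eq : ∀ u : ℂ → ℝ, InnerProductSpace.HarmonicContOnCl u G → ∫ z, u z ∂μ = u a

open Classical in
/-- The harmonic measure of `G` evaluated at `a` (it exists for bounded open `G` and `a ∈ G`, see
`isHarmonicMeasure_harmonicMeasure`; otherwise the value may be the junk value `0`). -/
def harmonicMeasure (G : Set ℂ) (a : ℂ) : Measure ℂ :=
  if h : ∃ μ, IsHarmonicMeasure G a μ then h.choose else 0

/-- The minimum principle. -/
theorem nonneg_of_nonneg_frontier {G : Set ℂ} (hG : IsOpen G) (hb : Bornology.IsBounded G)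
    {u : ℂ → ℝ} (hu : InnerProductSpace.HarmonicContOnCl u G) (h0 : ∀ z ∈ frontier G, 0 ≤ u z)
    {a : ℂ} (ha : a ∈ G) : 0 ≤ u a := by
  by_contra! hneg
  have hcl : IsCompact (closure G) := hb.isCompact_closure
  obtain ⟨z0, hz0, hmin⟩ := hcl.exists_isMinOn ⟨a, subset_closure ha⟩ hu.continuousOn
  set M : Set ℂ := {z ∈ closure G | u z = u z0} with hM
  have hMc : IsCompact M := by
    have : IsClosed M := by
      have := hu.continuousOn.preimage_isClosed_of_isClosed isClosed_closure
        (isClosed_singleton (x := u z0))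
      exact this
    exact hcl.of_isClosed_subset this (fun z hz => hz.1)
  obtain ⟨w, hw, hmax⟩ := hMc.exists_isMaxOn ⟨z0, hz0, rfl⟩ Complex.continuous_re.continuousOn
  have hle : ∀ z ∈ closure G, u w ≤ u z := fun z hz => by rw [hw.2]; exact hmin hz
  have hwneg : u w < 0 := lt_of_le_of_lt (hle a (subset_closure ha)) hneg
  have hwG : w ∈ G := by
    by_contra hwG
    have : w ∈ frontier G := by rw [hG.frontier_eq]; exact ⟨hw.1, hwG⟩
    exact absurd (h0 w this) (not_le.2 hwneg)
  obtain ⟨R, hR, hball⟩ := Metric.isOpen_iff.1 hG w hwG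
  obtain ⟨F, hF, hFu⟩ := InnerProductSpace.HarmonicOnNhd.exists_analyticOnNhd_ball_re_eq
    (hu.harmonicOnNhd.mono hball)
  have hnhds : ball w R ∈ 𝓝 w := ball_mem_nhds w hR
  have hnorm : ∀ z ∈ ball w R, ‖Complex.exp (-F z)‖ = Real.exp (-u z) := by
    intro z hz
    rw [Complex.norm_exp, Complex.neg_re]
    have := hFu hz
    simp only at this
    rw [this]
  have hloc : ∀ᶠ z in 𝓝 w, ‖Complex.exp (-F z)‖ = ‖Complex.exp (-F w)‖ := by
    apply Complex.norm_eventually_eq_of_isLocalMax (f := fun z => Complex.exp (-F z))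
    · filter_upwards [hnhds] with z hz
      exact ((hF z hz).differentiableAt.neg).cexp
    · filter_upwards [hnhds] with z hz
      simp only [Function.comp]
      rw [hnorm z hz, hnorm w (mem_ball_self hR)]
      exact Real.exp_le_exp.2 (neg_le_neg (hle z (subset_closure (hball hz))))
  obtain ⟨δ, hδ, hδ'⟩ := Metric.eventually_nhds_iff_ball.1 hloc
  set ε : ℝ := min δ R / 2 with hε
  have hmpos : 0 < min δ R := lt_min hδ hR
  have hεpos : 0 < ε := by positivity
  have hlt : ε < min δ R := half_lt_self hmpos
  have hd : dist (w + (ε : ℂ)) w = ε := by simp [dist_eq_norm, abs_of_pos hεpos]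
  have h1 : w + (ε : ℂ) ∈ ball w δ := by
    rw [mem_ball, hd]; exact hlt.trans_le (min_le_left _ _)
  have h2 : w + (ε : ℂ) ∈ ball w R := by
    rw [mem_ball, hd]; exact hlt.trans_le (min_le_right _ _)
  have h3 := hδ' _ h1
  rw [hnorm _ h2, hnorm w (mem_ball_self hR), Real.exp_eq_exp, neg_inj] at h3
  have h4 : w + (ε : ℂ) ∈ M := ⟨subset_closure (hball h2), by rw [h3, hw.2]⟩
  have h5 := hmax h4
  simp at h5
  linarith

/-- Harmonic measure exists on every bounded open set. -/
theorem exists_isHarmonicMeasure {G : Set ℂ} (hG : IsOpen G) (hb : Bornology.IsBounded G) {a : ℂ}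
    (ha : a ∈ G) : ∃ μ, IsHarmonicMeasure G a μ := by
  have hK : IsCompact (frontier G) :=
    hb.isCompact_closure.of_isClosed_subset isClosed_frontier frontier_subset_closure
  have : CompactSpace (frontier G) := isCompact_iff_compactSpace.1 hK
  let g : Submodule ℝ (C(frontier G, ℝ) × ℝ) :=
    { carrier := {x | ∃ u : ℂ → ℝ, InnerProductSpace.HarmonicContOnCl u G ∧
        (∀ z : frontier G, x.1 z = u z) ∧ x.2 = u a}
      add_mem' := by
        rintro x y ⟨u, hu, h1, h2⟩ ⟨v, hv, h3, h4⟩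
        exact ⟨u + v, hu.add hv, fun z => by simp [h1, h3], by simp [h2, h4]⟩
      zero_mem' := ⟨fun _ => 0, InnerProductSpace.harmonicContOnCl_const, by simp, by simp⟩
      smul_mem' := by
        rintro c x ⟨u, hu, h1, h2⟩
        exact ⟨c • u, hu.const_smul c, fun z => by simp [h1], by simp [h2]⟩ }
  have hpos : ∀ x ∈ g, (∀ z, 0 ≤ x.1 z) → 0 ≤ x.2 := by
    rintro x ⟨u, hu, h1, h2⟩ hx
    rw [h2]
    exact nonneg_of_nonneg_frontier hG hb hu (fun z hz => by rw [← h1 ⟨z, hz⟩]; exact hx _) ha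
  have hg : ∀ x ∈ g, x.1 = 0 → x.2 = 0 := by
    intro x hx h
    refine le_antisymm ?_ (hpos x hx (by simp [h]))
    have := hpos (-x) (g.neg_mem hx) (by simp [h])
    simpa using this
  have hgraph := g.toLinearPMap_graph_eq hg
  let s : PointedCone ℝ C(frontier G, ℝ) := ConvexCone.toPointedCone
    { carrier := {f | ∀ z, 0 ≤ f z}
      smul_mem' := by
        intro c hc f hf z
        exact mul_nonneg hc.le (hf z)
      add_mem' := by
        intro f hf f' hf' z
        exact add_nonneg (hf z) (hf' z) } (by
          intro z
          simp)
  have hs : ∀ f, f ∈ s ↔ ∀ z, 0 ≤ f z := fun f => Iff.rfl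
  have hmem : ∀ u : ℂ → ℝ, ∀ hu : InnerProductSpace.HarmonicContOnCl u G, ∀ f : C(frontier G, ℝ),
      (∀ z : frontier G, f z = u z) → (f, u a) ∈ g := fun u hu f hf => ⟨u, hu, hf, rfl⟩
  obtain ⟨Λ, hΛ, hΛpos⟩ := riesz_extension s g.toLinearPMap
    (fun x hx => hpos _ (g.mem_graph_toLinearPMap hg x) hx)
    (by
      intro f
      have h := hmem (fun _ => ‖f‖) InnerProductSpace.harmonicContOnCl_const
        (ContinuousMap.const _ ‖f‖) (fun _ => rfl)
      refine ⟨⟨ContinuousMap.const _ ‖f‖, Submodule.mem_map.2 ⟨_, h, rfl⟩⟩, ?_⟩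
      rw [hs]
      intro z
      have h1 := f.norm_coe_le_norm z
      have h2 := neg_abs_le (f z)
      rw [Real.norm_eq_abs] at h1
      simp only [ContinuousMap.add_apply, ContinuousMap.const_apply]
      linarith)
  have hΛg : ∀ x ∈ g, Λ x.1 = x.2 := by
    intro x hx
    have hx' := hx
    rw [← hgraph] at hx'
    obtain ⟨y, hy1, hy2⟩ := (LinearPMap.mem_graph_iff _).1 hx'
    rw [← hy1, hΛ y, hy2]
  let Λc : CompactlySupportedContinuousMap (frontier G) ℝ →ₚ[ℝ] ℝ :=
    PositiveLinearMap.mk₀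
      { toFun := fun f => Λ f.toContinuousMap
        map_add' := fun f f' => by rw [← map_add]; rfl
        map_smul' := fun c f => by rw [RingHom.id_apply, ← map_smul]; rfl }
      (by
        intro f hf
        exact hΛpos _ (fun z => hf z))
  set ν : Measure (frontier G) := RealRMK.rieszMeasure Λc with hν
  have hint : ∀ f : C(frontier G, ℝ), ∫ z, f z ∂ν = Λ f := by
    intro f
    exact RealRMK.integral_rieszMeasure Λc (CompactlySupportedContinuousMap.continuousMapEquiv f)
  have : IsFiniteMeasure ν := ⟨isCompact_univ.measure_lt_top⟩
  have hemb : MeasurableEmbedding (Subtype.val : frontier G → ℂ) :=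
    MeasurableEmbedding.subtype_coe isClosed_frontier.measurableSet
  have hint' : ∀ u : ℂ → ℝ, InnerProductSpace.HarmonicContOnCl u G →
      ∫ z, u z ∂(ν.map Subtype.val) = u a := by
    intro u hu
    rw [hemb.integral_map]
    have hc : Continuous fun z : frontier G => u z :=
      (hu.continuousOn.mono frontier_subset_closure).domRestrict
    have := hint ⟨_, hc⟩
    simp only [ContinuousMap.coe_mk] at this
    rw [this]
    exact hΛg _ (hmem u hu ⟨_, hc⟩ (fun _ => rfl))
  refine ⟨ν.map Subtype.val, ?_, ?_, hint'⟩
  · have : IsFiniteMeasure (ν.map (Subtype.val : frontier G → ℂ)) :=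
      Measure.isFiniteMeasure_map ν _
    have h1 := hint' (fun _ => 1) InnerProductSpace.harmonicContOnCl_const
    rw [integral_const, smul_eq_mul, mul_one] at h1
    refine ⟨?_⟩
    rw [← ENNReal.toReal_eq_one_iff]
    exact h1
  · rw [hemb.map_apply]
    have : (Subtype.val : frontier G → ℂ) ⁻¹' (frontier G)ᶜ = ∅ := by
      ext z; simp
    rw [this, measure_empty]

/-- The defining property of harmonic measure. -/
theorem isHarmonicMeasure_harmonicMeasure {G : Set ℂ} (hG : IsOpen G)
    (hb : Bornology.IsBounded G) {a : ℂ} (ha : a ∈ G) :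
    IsHarmonicMeasure G a (harmonicMeasure G a) := by
  have h := exists_isHarmonicMeasure hG hb ha
  rw [harmonicMeasure, dif_pos h]
  exact h.choose_spec

/-! ### The spaces `R^t(K, μ)` -/

/-- `Rat(K)`: the rational functions with poles off `K` (as functions on `ℂ`; their values at the
poles play no role). -/
def ratFunctions (K : Set ℂ) : Set (ℂ → ℂ) :=
  {q | ∃ p d : Polynomial ℂ, (∀ z ∈ K, d.eval z ≠ 0) ∧ q = fun z => p.eval z / d.eval z}

/-- `R^t(K, μ)`: the closure of `Rat(K)` in `L^t(μ)`. -/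
def rationalLp (K : Set ℂ) (t : ℝ≥0∞) [Fact (1 ≤ t)] (μ : Measure ℂ) : Set (Lp ℂ t μ) :=
  closure {f | ∃ q ∈ ratFunctions K, f =ᵐ[μ] q}

/-- The bounded point evaluations for `R^t(K, μ)`. -/
def bpe (K : Set ℂ) (t : ℝ≥0∞) (μ : Measure ℂ) : Set ℂ :=
  {z | z ∈ K ∧ ∃ C : ℝ, ∀ q ∈ ratFunctions K, ‖q z‖ ≤ C * (eLpNorm q t μ).toReal}

/-- The analytic bounded point evaluations for `R^t(K, μ)`. -/
def abpe (K : Set ℂ) (t : ℝ≥0∞) (μ : Measure ℂ) : Set ℂ :=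
  {z₀ | z₀ ∈ interior (bpe K t μ) ∧ ∃ r > 0, ∃ M > 0, ∀ z ∈ ball z₀ r, ∀ q ∈ ratFunctions K,
    ‖q z‖ ≤ M * (eLpNorm q t μ).toReal}

/-- The evaluation map `ρ`: for `f ∈ R^t(K, μ)` and a bounded point evaluation `z`, `ρ(f)(z)` is
the value at `f` of the continuous extension to `R^t(K, μ)` of the functional `q ↦ q(z)` on
`Rat(K)`, that is, the limit of `q(z)` as `q ∈ Rat(K)` tends to `f` in `L^t(μ)`. -/
def evalMap (K : Set ℂ) (t : ℝ≥0∞) (μ : Measure ℂ) (f : ℂ → ℂ) (z : ℂ) : ℂ :=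
  limUnder (comap (fun q : ratFunctions K => eLpNorm (fun w => f w - q.1 w) t μ) (𝓝 0))
    (fun q => q.1 z)

/-- Multiplication by `z` on `R^t(K, μ)` is irreducible: `R^t(K, μ)` contains no non-trivial
characteristic function. -/
def IsIrreducibleMul (K : Set ℂ) (t : ℝ≥0∞) [Fact (1 ≤ t)] (μ : Measure ℂ) : Prop :=
  ∀ A : Set ℂ, MeasurableSet A →
    (∃ f ∈ rationalLp K t μ, f =ᵐ[μ] A.indicator fun _ => (1 : ℂ)) → μ A = 0 ∨ μ Aᶜ = 0

/-! ### Non-tangential limits -/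

/-- The truncated upper cone `U_n(w, α)`. -/
def upperCone (n : ℕ) (w : ℂ) (α : ℝ) : Set ℂ :=
  {z | |(z - w).re| < α * (z - w).im} ∩ ball w (1 / n)

/-- The truncated lower cone `L_n(w, α)`. -/
def lowerCone (n : ℕ) (w : ℂ) (α : ℝ) : Set ℂ :=
  {z | |(z - w).re| < -α * (z - w).im} ∩ ball w (1 / n)

/-- `F`, a function on `Ω`, has limit `l` at `w` through the cone `U_n(w, α)`, which is contained in
`Ω` for some `n ≥ 1`. -/
def HasTopLimit (Ω : Set ℂ) (F : ℂ → ℂ) (w : ℂ) (α : ℝ) (l : ℂ) : Prop :=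
  ∃ n : ℕ, 0 < n ∧ upperCone n w α ⊆ Ω ∧ Tendsto F (𝓝[upperCone n w α] w) (𝓝 l)

/-- `F`, a function on `Ω`, has limit `l` at `w` through the cone `L_n(w, α)`, which is contained in
`Ω` for some `n ≥ 1`. -/
def HasBottomLimit (Ω : Set ℂ) (F : ℂ → ℂ) (w : ℂ) (α : ℝ) (l : ℂ) : Prop :=
  ∃ n : ℕ, 0 < n ∧ lowerCone n w α ⊆ Ω ∧ Tendsto F (𝓝[lowerCone n w α] w) (𝓝 l)

end MeanRational

end

/-!
Let `G` be one of the two parts of `int K`, and let `μ` be its harmonic measure at `a`. Since `μ`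
represents evaluation at `a` for analytic functions, division by `ζ - z` gives
`q(z) w(z) = ∫ q(ζ) (ζ - a) / (ζ - z) dμ(ζ)`, with a weight `w` analytic in `G` and `w(a) = 1`.
The zeros of `w` are isolated, so a small circle around any point of `G` avoids them, and the points
of `G` are analytic bounded point evaluations.

The conjugate of `z` lies outside the closure of `G`, so the Cauchy kernel at this point may be
subtracted in the formula without changing the result. The difference decays like a Poisson kernel.
Hence `ρ(f)` has the boundary limit `f(x)` in cones at every Lebesgue point `x` of `f` where `μ` has
a positive density with respect to length.

Almost every point of `K ∩ ℝ` is such a point because length there is absolutely continuous with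
respect to `μ`. Indeed, let `E` be a compact subset of `K ∩ ℝ` with `μ(E) = 0`. The unit circle and
the boundaries of the beads see their diameters at a right angle, so the Poisson integral of `E`,
that is, the angle subtended by `E`, is at most `π / 2` on the boundary of `G` outside `E`. By the
maximum principle it is at most `π / 2` in `G`. However, it tends to `π` at the density points of
`E`, so `E` has length zero.

Finally, a characteristic function in `R^t(K, ω)` is idempotent, so by multiplicativity of the point
evaluations it is constant on the boundary of each of the two parts. The constants agree since the
two harmonic measures are not mutually singular.
-/

noncomputable section

namespace MeanRational

/-! ### Half planes and cones -/

/-- The open upper (`σ = 1`) or lower (`σ = -1`) half plane. -/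
def halfPlane (σ : ℝ) : Set ℂ := {z | 0 < σ * z.im}

/-- The full cone of aperture `α` with vertex `x ∈ ℝ` in the half plane `halfPlane σ`; the cones
`upperCone n x α` and `lowerCone n x α` are its truncations for `σ = 1` and `σ = -1`. -/
def sideCone (σ α x : ℝ) : Set ℂ := {z | |z.re - x| < α * (σ * z.im)}

/-- Near `x ∈ ℝ` the set `G` contains the cones of every aperture with vertex `x` in the half plane
`halfPlane σ`. -/
def IsConePoint (G : Set ℂ) (σ x : ℝ) : Prop :=
  ∀ α : ℝ, 0 < α → ∀ᶠ z in 𝓝[sideCone σ α x] (x : ℂ), z ∈ G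

/-- `G` is a bounded domain (possibly empty) in the upper (`σ = 1`) or lower (`σ = -1`) half
plane. -/
structure IsHalfPlaneDomain (σ : ℝ) (G : Set ℂ) : Prop where
  abs_eq_one : |σ| = 1
  isOpen : IsOpen G
  isBounded : Bornology.IsBounded G
  isPreconnected : IsPreconnected G
  subset_halfPlane : G ⊆ halfPlane σ

theorem isOpen_halfPlane (σ : ℝ) : IsOpen (halfPlane σ) :=
  isOpen_lt continuous_const (continuous_const.mul Complex.continuous_im)

theorem mul_im_eq_abs_im {σ : ℝ} (hσ : |σ| = 1) {z : ℂ} (hz : 0 ≤ σ * z.im) :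
    σ * z.im = |z.im| := by
  rw [← abs_of_nonneg hz, abs_mul, hσ, one_mul]

theorem mul_im_nonneg_of_mem_closure {σ : ℝ} {G : Set ℂ} (hG : G ⊆ halfPlane σ) {z : ℂ}
    (hz : z ∈ closure G) : 0 ≤ σ * z.im :=
  closure_minimal (t := {w : ℂ | 0 ≤ σ * w.im}) (fun _ hw => le_of_lt (α := ℝ) (hG hw))
    (isClosed_le continuous_const (continuous_const.mul Complex.continuous_im)) hz

theorem sideCone_subset_halfPlane {α : ℝ} (hα : 0 < α) (σ x : ℝ) :
    sideCone σ α x ⊆ halfPlane σ :=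
  fun _ hz => pos_of_mul_pos_right ((abs_nonneg _).trans_lt hz) hα.le

theorem upperCone_eq (n : ℕ) (x α : ℝ) :
    upperCone n x α = sideCone 1 α x ∩ ball (x : ℂ) (1 / n) := by
  simp [upperCone, sideCone]

theorem lowerCone_eq (n : ℕ) (x α : ℝ) :
    lowerCone n x α = sideCone (-1) α x ∩ ball (x : ℂ) (1 / n) := by
  simp [lowerCone, sideCone]

theorem exists_inter_ball_subset_of_eventually {X : Type*} [PseudoMetricSpace X] {s t : Set X}
    {x : X} (h : ∀ᶠ z in 𝓝[s] x, z ∈ t) : ∃ n : ℕ, 0 < n ∧ s ∩ ball x (1 / n) ⊆ t := by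
  obtain ⟨ε, hε, hball⟩ := Metric.mem_nhdsWithin_iff.1 h
  obtain ⟨n, hn⟩ := exists_nat_one_div_lt hε
  exact ⟨n + 1, n.succ_pos, fun z hz =>
    hball ⟨ball_subset_ball (by exact_mod_cast hn.le) hz.2, hz.1⟩⟩

theorem hasTopLimit_of_tendsto {Ω : Set ℂ} {F : ℂ → ℂ} {x α : ℝ} {l : ℂ}
    (hΩ : ∀ᶠ z in 𝓝[sideCone 1 α x] (x : ℂ), z ∈ Ω)
    (hF : Tendsto F (𝓝[sideCone 1 α x] (x : ℂ)) (𝓝 l)) : HasTopLimit Ω F x α l := by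
  obtain ⟨n, hn, hsub⟩ := exists_inter_ball_subset_of_eventually hΩ
  refine ⟨n, hn, ?_, ?_⟩ <;> rw [upperCone_eq]
  exacts [hsub, hF.mono_left (nhdsWithin_mono _ inter_subset_left)]

theorem hasBottomLimit_of_tendsto {Ω : Set ℂ} {F : ℂ → ℂ} {x α : ℝ} {l : ℂ}
    (hΩ : ∀ᶠ z in 𝓝[sideCone (-1) α x] (x : ℂ), z ∈ Ω)
    (hF : Tendsto F (𝓝[sideCone (-1) α x] (x : ℂ)) (𝓝 l)) : HasBottomLimit Ω F x α l := by
  obtain ⟨n, hn, hsub⟩ := exists_inter_ball_subset_of_eventually hΩ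
  refine ⟨n, hn, ?_, ?_⟩ <;> rw [lowerCone_eq]
  exacts [hsub, hF.mono_left (nhdsWithin_mono _ inter_subset_left)]

/-! ### Geometry of string of beads sets -/

/-- The part of `int K` in the half plane `halfPlane σ`. -/
def sidePart (K : Set ℂ) (σ : ℝ) : Set ℂ := interior K ∩ halfPlane σ

/-- `K` is the closed unit disk without the disks with centres `c n` and radii `r n`. These are the
conditions in `IsStringOfBeads` for given `c` and `r`, except that `K ∩ ℝ` may be null. -/
structure IsBeads (K : Set ℂ) (c r : ℕ → ℝ) : Prop where
  pos : ∀ n, 0 < r n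
  ball_subset : ∀ n, ball (c n : ℂ) (r n) ⊆ ball 0 1
  disjoint : Pairwise fun i j =>
    Disjoint (closedBall (c i : ℂ) (r i)) (closedBall (c j : ℂ) (r j))
  eq_diff : K = closedBall 0 1 \ ⋃ n, ball (c n : ℂ) (r n)
  interior_real : interior {x : ℝ | (x : ℂ) ∈ K} = ∅

theorem IsStringOfBeads.exists_isBeads {K : Set ℂ} (hK : IsStringOfBeads K) :
    ∃ c r, IsBeads K c r := by
  obtain ⟨c, r, h1, h2, h3, h4, h5, -⟩ := hK
  exact ⟨c, r, h1, h2, h3, h4, h5⟩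

theorem IsStringOfBeads.volume_real_pos {K : Set ℂ} (hK : IsStringOfBeads K) :
    0 < volume {x : ℝ | (x : ℂ) ∈ K} := by
  obtain ⟨c, r, -, -, -, -, -, h⟩ := hK
  exact h

theorem isOpen_sidePart (K : Set ℂ) (σ : ℝ) : IsOpen (sidePart K σ) :=
  isOpen_interior.inter (isOpen_halfPlane σ)

theorem sidePart_subset {K : Set ℂ} {σ : ℝ} : sidePart K σ ⊆ K :=
  inter_subset_left.trans interior_subset

theorem upperPart_eq_sidePart (K : Set ℂ) : upperPart K = sidePart K 1 := by
  ext z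
  simp [upperPart, sidePart, halfPlane]

theorem norm_sq_eq_re_sq_add_im_sq (z : ℂ) : ‖z‖ ^ 2 = z.re ^ 2 + z.im ^ 2 := by
  rw [← Complex.normSq_eq_norm_sq, Complex.normSq_apply]
  ring

theorem norm_sub_ofReal_sq (z : ℂ) (t : ℝ) :
    ‖z - t‖ ^ 2 = ‖z‖ ^ 2 - 2 * t * z.re + t ^ 2 := by
  simp only [norm_sq_eq_re_sq_add_im_sq, Complex.sub_re, Complex.sub_im, Complex.ofReal_re,
    Complex.ofReal_im]
  ring

theorem eventually_norm_lt_and_lt_norm_sub {c r : ℕ → ℝ} {z : ℂ} (h1 : ‖z‖ < 1)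
    (h2 : ∀ n, r n < ‖z - c n‖) (N : ℕ) :
    ∀ᶠ w : ℂ in 𝓝 z, ‖w‖ < 1 ∧ ∀ n < N, r n < ‖w - c n‖ := by
  refine (continuousAt_id.norm.eventually_lt_const h1).and ?_
  refine (Set.finite_lt_nat N).eventually_all.2 fun n _ => ?_
  have : ContinuousAt (fun w : ℂ => ‖w - c n‖) z := by fun_prop
  exact this.eventually_const_lt (h2 n)

namespace IsBeads

variable {K : Set ℂ} {c r : ℕ → ℝ}

theorem mem_iff (h : IsBeads K c r) {z : ℂ} : z ∈ K ↔ ‖z‖ ≤ 1 ∧ ∀ n, r n ≤ ‖z - c n‖ := by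
  simp [h.eq_diff, dist_eq_norm]

theorem isCompact (h : IsBeads K c r) : IsCompact K := by
  rw [h.eq_diff]
  exact (isCompact_closedBall 0 1).diff (isOpen_iUnion fun _ => isOpen_ball)

theorem closure_sidePart_subset (h : IsBeads K c r) (σ : ℝ) : closure (sidePart K σ) ⊆ K :=
  closure_minimal sidePart_subset h.isCompact.isClosed

theorem Ioo_subset (h : IsBeads K c r) (n : ℕ) : Ioo (c n - r n) (c n + r n) ⊆ Icc (-1) 1 := by
  intro x hx
  have hxn : (x : ℂ) ∈ ball (c n : ℂ) (r n) := by
    rw [← Real.ball_eq_Ioo] at hx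
    rwa [mem_ball, Complex.dist_eq, ← Complex.ofReal_sub, Complex.norm_real, ← dist_eq_norm]
  have := h.ball_subset n hxn
  rw [mem_ball_zero_iff, Complex.norm_real, Real.norm_eq_abs] at this
  exact abs_le.1 this.le

theorem pairwise_disjoint_Ioo (h : IsBeads K c r) :
    Pairwise fun i j => Disjoint (Ioo (c i - r i) (c i + r i)) (Ioo (c j - r j) (c j + r j)) := by
  have hmem : ∀ n, ∀ x ∈ Ioo (c n - r n) (c n + r n), (x : ℂ) ∈ closedBall (c n : ℂ) (r n) := by
    intro n x hx
    rw [← Real.ball_eq_Ioo] at hx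
    rw [mem_closedBall, Complex.dist_eq, ← Complex.ofReal_sub, Complex.norm_real, ← dist_eq_norm]
    exact (mem_ball.1 hx).le
  exact fun i j hij => Set.disjoint_left.2 fun x hi hj =>
    Set.disjoint_left.1 (h.disjoint hij) (hmem i x hi) (hmem j x hj)

theorem tsum_ofReal_radius_ne_top (h : IsBeads K c r) : ∑' n, ENNReal.ofReal (r n) ≠ ∞ := by
  refine ne_top_of_le_ne_top (b := volume (Icc (-1 : ℝ) 1)) (by simp) ?_
  calc ∑' n, ENNReal.ofReal (r n)
      ≤ ∑' n, volume (Ioo (c n - r n) (c n + r n)) := by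
        refine ENNReal.tsum_le_tsum fun n => ?_
        rw [Real.volume_Ioo]
        exact ENNReal.ofReal_le_ofReal (by linarith [h.pos n])
    _ = volume (⋃ n, Ioo (c n - r n) (c n + r n)) :=
        (measure_iUnion h.pairwise_disjoint_Ioo fun _ => measurableSet_Ioo).symm
    _ ≤ volume (Icc (-1 : ℝ) 1) := measure_mono (iUnion_subset h.Ioo_subset)

theorem eventually_radius_lt (h : IsBeads K c r) {ε : ℝ} (hε : 0 < ε) : ∀ᶠ n in atTop, r n < ε := by
  have := ENNReal.tendsto_atTop_zero_of_tsum_ne_top h.tsum_ofReal_radius_ne_top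
  filter_upwards [this.eventually_lt_const (ENNReal.ofReal_pos.2 hε)] with n hn
  exact (ENNReal.ofReal_lt_ofReal_iff hε).1 hn

theorem im_ne_zero (h : IsBeads K c r) {z : ℂ} (hz : z ∈ interior K) : z.im ≠ 0 := by
  intro h0
  have hz' : (z.re : ℂ) ∈ interior K := by
    rwa [show (z.re : ℂ) = z from Complex.ext rfl h0.symm]
  have : z.re ∈ interior {x : ℝ | (x : ℂ) ∈ K} :=
    interior_maximal (preimage_mono interior_subset)
      (isOpen_interior.preimage Complex.continuous_ofReal) hz'
  simp [h.interior_real] at this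

theorem norm_lt_one_of_mem_interior (h : IsBeads K c r) {z : ℂ} (hz : z ∈ interior K) :
    ‖z‖ < 1 := by
  have : z ∈ interior (closedBall (0 : ℂ) 1) :=
    interior_mono (fun w hw => by simpa using (h.mem_iff.1 hw).1) hz
  simpa [interior_closedBall _ one_ne_zero] using this

theorem radius_lt_of_mem_interior (h : IsBeads K c r) {z : ℂ} (hz : z ∈ interior K) (n : ℕ) :
    r n < ‖z - c n‖ := by
  by_contra! hle
  have hcl : z ∈ closure (ball (c n : ℂ) (r n)) := by
    rwa [closure_ball _ (h.pos n).ne', mem_closedBall, dist_eq_norm]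
  obtain ⟨w, hw, hwn⟩ := mem_closure_iff.1 hcl _ isOpen_interior hz
  rw [mem_ball, dist_eq_norm] at hwn
  exact hwn.not_ge ((h.mem_iff.1 (interior_subset hw)).2 n)

theorem mem_interior_iff (h : IsBeads K c r) {z : ℂ} (hz : z.im ≠ 0) :
    z ∈ interior K ↔ ‖z‖ < 1 ∧ ∀ n, r n < ‖z - c n‖ := by
  refine ⟨fun hm => ⟨h.norm_lt_one_of_mem_interior hm, h.radius_lt_of_mem_interior hm⟩, ?_⟩
  rintro ⟨h1, h2⟩
  obtain ⟨N, hN⟩ := eventually_atTop.1 (h.eventually_radius_lt (half_pos (abs_pos.2 hz)))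
  have him : ∀ᶠ w : ℂ in 𝓝 z, |z.im| / 2 < |w.im| :=
    Complex.continuous_im.continuousAt.abs.eventually_const_lt (half_lt_self (abs_pos.2 hz))
  rw [mem_interior_iff_mem_nhds]
  filter_upwards [eventually_norm_lt_and_lt_norm_sub h1 h2 N, him] with w ⟨w1, w2⟩ w3
  refine h.mem_iff.2 ⟨w1.le, fun n => ?_⟩
  rcases lt_or_ge n N with hn | hn
  · exact (w2 n hn).le
  · have := Complex.abs_im_le_norm (w - c n)
    simp only [Complex.sub_im, Complex.ofReal_im, sub_zero] at this
    linarith [hN n hn]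

theorem lowerPart_eq_sidePart (h : IsBeads K c r) : lowerPart K = sidePart K (-1) := by
  ext z
  simp only [lowerPart, upperPart, sidePart, halfPlane, Set.mem_sdiff, mem_ofPred_eq, mem_inter_iff,
    not_and, not_lt]
  refine and_congr_right fun hz => ?_
  have := h.im_ne_zero hz
  exact ⟨fun hle => by linarith [lt_of_le_of_ne (hle hz) this], fun hlt _ => by linarith⟩

theorem conj_mem_sidePart_neg (h : IsBeads K c r) {σ : ℝ} {z : ℂ} (hz : z ∈ sidePart K σ) :
    starRingEnd ℂ z ∈ sidePart K (-σ) := by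
  have him := h.im_ne_zero hz.1
  refine ⟨(h.mem_interior_iff (by simpa using him)).2 ?_, by simpa [halfPlane] using hz.2⟩
  obtain ⟨h1, h2⟩ := (h.mem_interior_iff him).1 hz.1
  refine ⟨by rwa [Complex.norm_conj], fun n => ?_⟩
  rw [← Complex.conj_ofReal, ← map_sub, Complex.norm_conj]
  exact h2 n

theorem norm_eq_one_or_eq_radius_of_mem_frontier (h : IsBeads K c r) {σ : ℝ} {z : ℂ}
    (hz : z ∈ frontier (sidePart K σ)) (him : z.im ≠ 0) :
    ‖z‖ = 1 ∨ ∃ n, ‖z - c n‖ = r n := by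
  by_contra! hcon
  have hzK := h.mem_iff.1 (h.closure_sidePart_subset σ hz.1)
  have hint : z ∈ interior K := (h.mem_interior_iff him).2
    ⟨lt_of_le_of_ne hzK.1 hcon.1, fun n => lt_of_le_of_ne (hzK.2 n) (hcon.2 n).symm⟩
  have hnot : z ∉ halfPlane σ := fun hs =>
    ((isOpen_sidePart K σ).frontier_eq ▸ hz).2 ⟨hint, hs⟩
  have h0 : σ = 0 := by
    have := mul_im_nonneg_of_mem_closure inter_subset_right hz.1
    exact (mul_eq_zero.1 (this.antisymm (not_lt.1 hnot)).symm).resolve_right him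
  simp [sidePart, halfPlane, h0] at hz

/-- The condition `x² < s` and, for each bead, the condition of lying outside it are convex in the
coordinates `x = Re z` and `s = |z|²`. -/
theorem convex_lift (c r : ℕ → ℝ) : Convex ℝ {p : ℝ × ℝ | p.1 ^ 2 < p.2 ∧ p.2 < 1 ∧
    ∀ n, r n ^ 2 < p.2 - 2 * c n * p.1 + c n ^ 2} := by
  have h1 : Convex ℝ {p : ℝ × ℝ | p.1 ^ 2 < p.2} := by
    simpa using (even_two.convexOn_pow (𝕜 := ℝ)).convex_strict_epigraph
  have h2 : Convex ℝ {p : ℝ × ℝ | p.2 < 1} :=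
    convex_halfSpace_lt (LinearMap.snd ℝ ℝ ℝ).isLinear 1
  have h3 : ∀ n, Convex ℝ {p : ℝ × ℝ | r n ^ 2 < p.2 - 2 * c n * p.1 + c n ^ 2} := by
    intro n
    have hlin := convex_halfSpace_gt
      (LinearMap.snd ℝ ℝ ℝ - (2 * c n) • LinearMap.fst ℝ ℝ ℝ).isLinear (r n ^ 2 - c n ^ 2)
    simpa [sub_lt_iff_lt_add] using hlin
  convert h1.inter (h2.inter (convex_iInter h3)) using 1
  ext p
  simp

theorem sidePart_eq_image (h : IsBeads K c r) {σ : ℝ} (hσ : |σ| = 1) :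
    sidePart K σ = (fun p : ℝ × ℝ => (⟨p.1, σ * √(p.2 - p.1 ^ 2)⟩ : ℂ)) ''
      {p | p.1 ^ 2 < p.2 ∧ p.2 < 1 ∧ ∀ n, r n ^ 2 < p.2 - 2 * c n * p.1 + c n ^ 2} := by
  have hσ2 : σ ^ 2 = 1 := by rw [← sq_abs, hσ, one_pow]
  have mem_iff : ∀ z : ℂ, z ∈ sidePart K σ ↔ 0 < σ * z.im ∧ ‖z‖ ^ 2 < 1 ∧
      ∀ n, r n ^ 2 < ‖z‖ ^ 2 - 2 * c n * z.re + c n ^ 2 := by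
    intro z
    rw [sidePart, mem_inter_iff, and_comm]
    refine and_congr_right fun hz => ?_
    rw [h.mem_interior_iff (right_ne_zero_of_mul hz.ne')]
    simp only [← norm_sub_ofReal_sq, sq_lt_sq₀ (h.pos _).le (norm_nonneg _),
      sq_lt_one_iff₀ (norm_nonneg z)]
  ext z
  rw [mem_iff, Set.mem_image]
  constructor
  · rintro ⟨hz, h1, h2⟩
    have him := sq_pos_of_ne_zero (right_ne_zero_of_mul hz.ne')
    refine ⟨(z.re, ‖z‖ ^ 2), ⟨?_, h1, h2⟩, Complex.ext rfl ?_⟩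
    · simp only [norm_sq_eq_re_sq_add_im_sq]
      linarith
    · simp only [norm_sq_eq_re_sq_add_im_sq, add_sub_cancel_left, Real.sqrt_sq_eq_abs]
      rw [← mul_im_eq_abs_im hσ hz.le, ← mul_assoc, ← sq, hσ2, one_mul]
  · rintro ⟨⟨x, s⟩, ⟨h0, h1, h2⟩, rfl⟩
    simp only at h0 h1 h2
    have hs : 0 < s - x ^ 2 := sub_pos.2 h0
    have hn : ‖(⟨x, σ * √(s - x ^ 2)⟩ : ℂ)‖ ^ 2 = s := by
      rw [norm_sq_eq_re_sq_add_im_sq, mul_pow, hσ2, Real.sq_sqrt hs.le]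
      ring
    refine ⟨?_, by rwa [hn], by rwa [hn]⟩
    rw [← mul_assoc, ← sq, hσ2, one_mul]
    exact Real.sqrt_pos.2 hs

theorem isPreconnected_sidePart (h : IsBeads K c r) {σ : ℝ} (hσ : |σ| = 1) :
    IsPreconnected (sidePart K σ) := by
  rw [h.sidePart_eq_image hσ]
  refine (convex_lift c r).isPreconnected.image _ (Continuous.continuousOn ?_)
  simp only [Complex.mk_eq_add_mul_I]
  fun_prop

theorem isHalfPlaneDomain_sidePart (h : IsBeads K c r) {σ : ℝ} (hσ : |σ| = 1) :
    IsHalfPlaneDomain σ (sidePart K σ) where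
  abs_eq_one := hσ
  isOpen := isOpen_sidePart K σ
  isBounded := h.isCompact.isBounded.subset sidePart_subset
  isPreconnected := h.isPreconnected_sidePart hσ
  subset_halfPlane := inter_subset_right

theorem ae_eventually_notMem_closedBall (h : IsBeads K c r) (M : ℕ) :
    ∀ᵐ x : ℝ, ∀ᶠ n in atTop, x ∉ closedBall (c n) (M * r n) := by
  refine ae_eventually_notMem ?_
  have hvol : ∀ n, volume (closedBall (c n) (M * r n)) =
      ENNReal.ofReal (2 * M) * ENNReal.ofReal (r n) := fun n => by
    rw [Real.volume_closedBall, ← mul_assoc, ENNReal.ofReal_mul (by positivity)]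
  simp_rw [hvol, ENNReal.tsum_mul_left]
  exact ENNReal.mul_ne_top ENNReal.ofReal_ne_top h.tsum_ofReal_radius_ne_top

theorem ae_norm_lt_one_and_radius_lt (h : IsBeads K c r) :
    ∀ᵐ x : ℝ, (x : ℂ) ∈ K → ‖(x : ℂ)‖ < 1 ∧ ∀ n, r n < ‖(x : ℂ) - c n‖ := by
  have hc : ∀ t s : ℝ, ∀ᵐ x : ℝ, ‖(x : ℂ) - t‖ ≠ s := fun t s => by
    have hfin : {x : ℝ | |x - t| = s}.Finite := by
      refine (Set.toFinite {t + s, t - s}).subset fun x (hx : |x - t| = s) => ?_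
      rcases eq_or_eq_neg_of_abs_eq hx with h | h
      exacts [Or.inl (by linarith), Or.inr (by rw [mem_singleton_iff]; linarith)]
    filter_upwards [hfin.countable.ae_notMem volume] with x hx
    rwa [← Complex.ofReal_sub, Complex.norm_real, Real.norm_eq_abs]
  filter_upwards [hc 0 1, ae_all_iff.2 fun n => hc (c n) (r n)] with x hx1 hx2 hxK
  obtain ⟨h1, h2⟩ := h.mem_iff.1 hxK
  exact ⟨lt_of_le_of_ne h1 (by simpa using hx1), fun n => lt_of_le_of_ne (h2 n) (hx2 n).symm⟩

theorem isConePoint_sidePart (h : IsBeads K c r) {σ x : ℝ} (hσ : |σ| = 1) (h1 : ‖(x : ℂ)‖ < 1)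
    (h2 : ∀ n, r n < ‖(x : ℂ) - c n‖)
    (h3 : ∀ M : ℕ, ∀ᶠ n in atTop, x ∉ closedBall (c n) (M * r n)) :
    IsConePoint (sidePart K σ) σ x := by
  intro α hα
  obtain ⟨M, hM⟩ := exists_nat_ge α
  obtain ⟨N, hN⟩ := eventually_atTop.1 (h3 (M + 1))
  filter_upwards [(eventually_norm_lt_and_lt_norm_sub h1 h2 N).filter_mono nhdsWithin_le_nhds,
    self_mem_nhdsWithin] with z ⟨z1, z2⟩ hz
  have hside := sideCone_subset_halfPlane hα σ x hz
  refine ⟨(h.mem_interior_iff (right_ne_zero_of_mul hside.ne')).2 ⟨z1, fun n => ?_⟩, hside⟩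
  rcases lt_or_ge n N with hn | hn
  · exact z2 n hn
  by_contra! hle
  have hre := (Complex.abs_re_le_norm (z - c n)).trans hle
  have him := (Complex.abs_im_le_norm (z - c n)).trans hle
  simp only [Complex.sub_re, Complex.ofReal_re, Complex.sub_im, Complex.ofReal_im, sub_zero]
    at hre him
  refine hN n hn (mem_closedBall.2 ?_)
  calc dist x (c n) ≤ |z.re - x| + |z.re - c n| := by
        simpa only [Real.dist_eq, abs_sub_comm] using dist_triangle x z.re (c n)
    _ ≤ α * |z.im| + r n := add_le_add (mul_im_eq_abs_im hσ hside.le ▸ le_of_lt hz) hre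
    _ ≤ M * r n + r n := by gcongr
    _ = (M + 1 : ℕ) * r n := by push_cast; ring

theorem ae_isConePoint_sidePart (h : IsBeads K c r) {σ : ℝ} (hσ : |σ| = 1) :
    ∀ᵐ x : ℝ, (x : ℂ) ∈ K → IsConePoint (sidePart K σ) σ x := by
  filter_upwards [ae_all_iff.2 h.ae_eventually_notMem_closedBall, h.ae_norm_lt_one_and_radius_lt]
    with x h3 h12 hxK
  exact h.isConePoint_sidePart hσ (h12 hxK).1 (h12 hxK).2 h3

end IsBeads

/-! ### Measures representing a point for analytic functions -/

theorem differentiableAt_integral_mul_inv_sub {α : Type*} [MeasurableSpace α] {ν : Measure α}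
    {p g : α → ℂ} {S : Set ℂ} (hS : IsClosed S) (hp : AEStronglyMeasurable p ν)
    (hpS : ∀ᵐ x ∂ν, p x ∈ S) (hg : Integrable g ν) {z : ℂ} (hz : z ∉ S) :
    DifferentiableAt ℂ (fun w => ∫ x, g x * (p x - w)⁻¹ ∂ν) z := by
  obtain ⟨ε, hε, hball⟩ := Metric.isOpen_iff.1 hS.isOpen_compl z hz
  have hε2 := half_pos hε
  have hfar : ∀ w ∈ ball z (ε / 2), ∀ s ∈ S, ε / 2 ≤ ‖s - w‖ := by
    intro w hw s hs
    by_contra! hlt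
    refine hball ?_ hs
    calc dist s z ≤ dist s w + dist w z := dist_triangle _ _ _
      _ < ε / 2 + ε / 2 := add_lt_add (by rwa [dist_eq_norm]) hw
      _ = ε := add_halves ε
  have hmeas : ∀ w, AEStronglyMeasurable (fun x => (p x - w)⁻¹) ν := fun w =>
    (measurable_inv.comp_aemeasurable (hp.aemeasurable.sub_const w)).aestronglyMeasurable
  refine (hasDerivAt_integral_of_dominated_loc_of_deriv_le
    (F' := fun w x => g x * ((p x - w)⁻¹ * (p x - w)⁻¹))
    (bound := fun x => ‖g x‖ * ((ε / 2)⁻¹ * (ε / 2)⁻¹)) (ball_mem_nhds z hε2)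
    (Eventually.of_forall fun w => hg.aestronglyMeasurable.mul (hmeas w)) ?_
    (hg.aestronglyMeasurable.mul ((hmeas z).mul (hmeas z))) ?_ (hg.norm.mul_const _)
    ?_).2.differentiableAt
  · refine hg.mul_bdd (c := (ε / 2)⁻¹) (hmeas z) ?_
    filter_upwards [hpS] with x hx
    rw [norm_inv]
    exact inv_anti₀ hε2 (hfar z (mem_ball_self hε2) _ hx)
  · filter_upwards [hpS] with x hx w hw
    have := inv_anti₀ hε2 (hfar w hw _ hx)
    rw [norm_mul, norm_mul, norm_inv]
    gcongr
  · filter_upwards [hpS] with x hx w hw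
    have hne : p x - w ≠ 0 := norm_pos_iff.1 (hε2.trans_le (hfar w hw _ hx))
    have hsub : HasDerivAt (fun w => p x - w) (-1) w := by
      simpa using (hasDerivAt_id w).const_sub (p x)
    refine ((hsub.inv hne).const_mul (g x)).congr_deriv ?_
    field_simp

/-- The Cauchy kernel at `z`, normalized at `a`. -/
def cauchyKernel (a z ζ : ℂ) : ℂ := (ζ - a) * (ζ - z)⁻¹

/-- The Cauchy transform of `(ζ - a) μ`. If `μ` represents evaluation at `a` for the functions
analytic in `G`, then, for `z ∈ G`, evaluation at `z` is represented by the kernel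
`cauchyKernel a z` divided by this weight. -/
def cauchyWeight (μ : Measure ℂ) (a z : ℂ) : ℂ := ∫ ζ, cauchyKernel a z ζ ∂μ

theorem continuousOn_cauchyKernel {a z : ℂ} {S : Set ℂ} (hz : z ∉ S) :
    ContinuousOn (cauchyKernel a z) S :=
  ContinuousOn.mul (by fun_prop)
    (ContinuousOn.inv₀ (by fun_prop) fun _ hζ => sub_ne_zero.2 fun h => hz (h ▸ hζ))

theorem notMem_frontier_of_mem {X : Type*} [TopologicalSpace X] {G : Set X} (hG : IsOpen G) {z : X}
    (hz : z ∈ G) : z ∉ frontier G := fun h => (hG.frontier_eq ▸ h).2 hz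

theorem isCompact_frontier {X : Type*} [PseudoMetricSpace X] [ProperSpace X] {G : Set X}
    (hb : Bornology.IsBounded G) : IsCompact (frontier G) :=
  hb.isCompact_closure.of_isClosed_subset isClosed_frontier frontier_subset_closure

theorem le_of_forall_pow_le_mul_pow {x y M : ℝ} (hy : 0 ≤ y) (h : ∀ n : ℕ, x ^ n ≤ M * y ^ n) :
    x ≤ y := by
  by_contra! hlt
  have hx : 0 < x := hy.trans_lt hlt
  have hlim : Tendsto (fun n => M * (y / x) ^ n) atTop (𝓝 (M * 0)) :=
    (tendsto_pow_atTop_nhds_zero_of_lt_one (by positivity) ((div_lt_one hx).2 hlt)).const_mul M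
  have : (1 : ℝ) ≤ M * 0 := ge_of_tendsto' hlim fun n => by
    rw [div_pow, ← mul_div_assoc, le_div_iff₀ (pow_pos hx n), one_mul]
    exact h n
  linarith

namespace IsHarmonicMeasure

variable {G : Set ℂ} {a : ℂ} {μ : Measure ℂ} {q : ℂ → ℂ}

theorem ae_mem_frontier (hμ : IsHarmonicMeasure G a μ) : ∀ᵐ ζ ∂μ, ζ ∈ frontier G :=
  hμ.measure_compl_frontier

theorem integrable_of_continuousOn (hμ : IsHarmonicMeasure G a μ) (hb : Bornology.IsBounded G)
    (hq : ContinuousOn q (frontier G)) : Integrable q μ := by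
  have := hμ.isProbabilityMeasure
  rw [← Measure.restrict_eq_self_of_ae_mem hμ.ae_mem_frontier]
  exact hq.integrableOn_compact (isCompact_frontier hb)

theorem integral_eq_of_diffContOnCl (hμ : IsHarmonicMeasure G a μ) (hG : IsOpen G)
    (hb : Bornology.IsBounded G) (hq : DiffContOnCl ℂ q G) : ∫ ζ, q ζ ∂μ = q a := by
  have hint := hμ.integrable_of_continuousOn hb (hq.continuousOn.mono frontier_subset_closure)
  have han : ∀ z ∈ G, AnalyticAt ℂ q z := fun z hz =>
    hq.differentiableOn.analyticAt (hG.mem_nhds hz)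
  have hre := hμ.integral_eq (fun z => (q z).re)
    ⟨fun z hz => (han z hz).harmonicAt_re, Complex.continuous_re.comp_continuousOn hq.continuousOn⟩
  have him := hμ.integral_eq (fun z => (q z).im)
    ⟨fun z hz => (han z hz).harmonicAt_im, Complex.continuous_im.comp_continuousOn hq.continuousOn⟩
  exact Complex.ext ((Complex.reCLM.integral_comp_comm hint).symm.trans hre)
    ((Complex.imCLM.integral_comp_comm hint).symm.trans him)

theorem integrable_mul_cauchyKernel (hμ : IsHarmonicMeasure G a μ) (hb : Bornology.IsBounded G)
    (hq : ContinuousOn q (frontier G)) {z : ℂ} (hz : z ∉ frontier G) :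
    Integrable (fun ζ => q ζ * cauchyKernel a z ζ) μ :=
  hμ.integrable_of_continuousOn hb (hq.mul (continuousOn_cauchyKernel hz))

theorem mul_cauchyWeight (hμ : IsHarmonicMeasure G a μ) (hG : IsOpen G)
    (hb : Bornology.IsBounded G) (hq : DiffContOnCl ℂ q G) {z : ℂ} (hz : z ∈ G) :
    q z * cauchyWeight μ a z = ∫ ζ, q ζ * cauchyKernel a z ζ ∂μ := by
  have hzf := notMem_frontier_of_mem hG hz
  have hnhds : G ∈ 𝓝 z := hG.mem_nhds hz
  have hds : DiffContOnCl ℂ (fun w => dslope q z w * (w - a)) G := by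
    refine ⟨((Complex.differentiableOn_dslope hnhds).2 hq.differentiableOn).mul (by fun_prop),
      ContinuousOn.mul ?_ (by fun_prop)⟩
    exact (continuousOn_dslope (mem_of_superset hnhds subset_closure)).2
      ⟨hq.continuousOn, hq.differentiableAt hG hz⟩
  have hslope : ∫ ζ, dslope q z ζ * (ζ - a) ∂μ
      = ∫ ζ, (q ζ * cauchyKernel a z ζ - q z * cauchyKernel a z ζ) ∂μ := by
    refine integral_congr_ae ?_
    filter_upwards [hμ.ae_mem_frontier] with ζ hζ
    have hne : ζ ≠ z := fun h => hzf (h ▸ hζ)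
    rw [dslope_of_ne _ hne, slope_def_field, cauchyKernel]
    field_simp [sub_ne_zero.2 hne]
  have hzero := hμ.integral_eq_of_diffContOnCl hG hb hds
  rw [hslope, sub_self, mul_zero, integral_sub
    (hμ.integrable_mul_cauchyKernel hb (hq.continuousOn.mono frontier_subset_closure) hzf)
    (hμ.integrable_mul_cauchyKernel hb continuousOn_const hzf), integral_const_mul,
    sub_eq_zero] at hzero
  exact hzero.symm

theorem integral_mul_cauchyKernel_eq_zero (hμ : IsHarmonicMeasure G a μ) (hG : IsOpen G)
    (hb : Bornology.IsBounded G) (hq : DiffContOnCl ℂ q G) {z : ℂ} (hz : z ∉ closure G) :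
    ∫ ζ, q ζ * cauchyKernel a z ζ ∂μ = 0 := by
  have hds : DiffContOnCl ℂ (fun w => q w * cauchyKernel a z w) G := by
    refine ⟨hq.differentiableOn.mul (DifferentiableOn.mul (by fun_prop) ?_),
      hq.continuousOn.mul (continuousOn_cauchyKernel hz)⟩
    exact DifferentiableOn.inv (by fun_prop) fun w hw =>
      sub_ne_zero.2 fun h => hz (h ▸ subset_closure hw)
  simpa [cauchyKernel] using hμ.integral_eq_of_diffContOnCl hG hb hds

theorem analyticOnNhd_cauchyWeight (hμ : IsHarmonicMeasure G a μ) (hG : IsOpen G)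
    (hb : Bornology.IsBounded G) : AnalyticOnNhd ℂ (cauchyWeight μ a) G := by
  refine DifferentiableOn.analyticOnNhd (fun z hz => ?_) hG
  exact (differentiableAt_integral_mul_inv_sub isClosed_frontier aestronglyMeasurable_id
    hμ.ae_mem_frontier (hμ.integrable_of_continuousOn hb (q := fun ζ => ζ - a) (by fun_prop))
    (notMem_frontier_of_mem hG hz)).differentiableWithinAt

theorem cauchyWeight_self (hμ : IsHarmonicMeasure G a μ) (hG : IsOpen G) (ha : a ∈ G) :
    cauchyWeight μ a a = 1 := by
  have := hμ.isProbabilityMeasure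
  have : cauchyWeight μ a a = ∫ _, (1 : ℂ) ∂μ := by
    refine integral_congr_ae ?_
    filter_upwards [hμ.ae_mem_frontier] with ζ hζ
    exact mul_inv_cancel₀ (sub_ne_zero.2 fun h => notMem_frontier_of_mem hG ha (h ▸ hζ))
  simp [this]

/-- The zeros of the weight, which is analytic and equal to `1` at `a`, are isolated. -/
theorem exists_sphere_le_norm_cauchyWeight (hμ : IsHarmonicMeasure G a μ) (hG : IsOpen G)
    (hb : Bornology.IsBounded G) (hconn : IsPreconnected G) (ha : a ∈ G) {z₀ : ℂ} (hz₀ : z₀ ∈ G) :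
    ∃ ρ > 0, closedBall z₀ ρ ⊆ G ∧ ∃ κ > 0, ∀ z ∈ sphere z₀ ρ, κ ≤ ‖cauchyWeight μ a z‖ := by
  have han := hμ.analyticOnNhd_cauchyWeight hG hb
  have hev : ∀ᶠ z in 𝓝[≠] z₀, cauchyWeight μ a z ≠ 0 := by
    by_contra hcon
    have hfreq : ∃ᶠ z in 𝓝[≠] z₀, cauchyWeight μ a z = 0 := by
      simpa only [ne_eq, not_not] using not_eventually.1 hcon
    have := han.eqOn_zero_of_preconnected_of_frequently_eq_zero hconn hz₀ hfreq ha
    simp [hμ.cauchyWeight_self hG ha] at this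
  obtain ⟨ε, hε, hball⟩ := Metric.eventually_nhds_iff_ball.1
    ((eventually_nhdsWithin_iff.1 hev).and (hG.eventually_mem hz₀))
  have hρ : 0 < ε / 2 := half_pos hε
  have hsub : closedBall z₀ (ε / 2) ⊆ ball z₀ ε := closedBall_subset_ball (half_lt_self hε)
  have hclG : closedBall z₀ (ε / 2) ⊆ G := fun z hz => (hball z (hsub hz)).2
  obtain ⟨w, hw, hmin⟩ := (isCompact_sphere z₀ (ε / 2)).exists_isMinOn
    (NormedSpace.sphere_nonempty.2 hρ.le)
    (han.continuousOn.mono (sphere_subset_closedBall.trans hclG)).norm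
  have hw0 : cauchyWeight μ a w ≠ 0 :=
    (hball w (hsub (sphere_subset_closedBall hw))).1 (ne_of_mem_sphere hw hρ.ne')
  exact ⟨ε / 2, hρ, hclG, _, norm_pos_iff.2 hw0, fun z hz => hmin hz⟩

theorem exists_norm_mul_norm_cauchyWeight_le (hμ : IsHarmonicMeasure G a μ) (hG : IsOpen G)
    (hb : Bornology.IsBounded G) {S : Set ℂ} (hS : IsCompact S) (hSG : S ⊆ G) :
    ∃ C > 0, ∀ z ∈ S, ∀ q : ℂ → ℂ, DiffContOnCl ℂ q G →
      ‖q z‖ * ‖cauchyWeight μ a z‖ ≤ C * ∫ ζ, ‖q ζ‖ ∂μ := by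
  have hcont : ContinuousOn (fun p : ℂ × ℂ => cauchyKernel a p.1 p.2) (S ×ˢ frontier G) := by
    refine ContinuousOn.mul (by fun_prop) (ContinuousOn.inv₀ (by fun_prop) fun p hp => ?_)
    exact sub_ne_zero.2 fun h => notMem_frontier_of_mem hG (hSG hp.1) (h ▸ hp.2)
  obtain ⟨C, hC⟩ := (hS.prod (isCompact_frontier hb)).exists_bound_of_continuousOn hcont
  refine ⟨max C 1, by positivity, fun z hz q hq => ?_⟩
  rw [← norm_mul, hμ.mul_cauchyWeight hG hb hq (hSG hz), ← integral_const_mul]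
  have hint := hμ.integrable_of_continuousOn hb (hq.continuousOn.mono frontier_subset_closure)
  refine norm_integral_le_of_norm_le (hint.norm.const_mul _) ?_
  filter_upwards [hμ.ae_mem_frontier] with ζ hζ
  rw [norm_mul, mul_comm]
  gcongr
  exact (hC (z, ζ) ⟨hz, hζ⟩).trans (le_max_left _ _)

theorem exists_norm_le_integral_norm (hμ : IsHarmonicMeasure G a μ) (hG : IsOpen G)
    (hb : Bornology.IsBounded G) (hconn : IsPreconnected G) (ha : a ∈ G) {z₀ : ℂ} (hz₀ : z₀ ∈ G) :
    ∃ ρ > 0, ∃ M > 0, ball z₀ ρ ⊆ G ∧ ∀ z ∈ ball z₀ ρ, ∀ q : ℂ → ℂ, DiffContOnCl ℂ q G →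
      ‖q z‖ ≤ M * ∫ ζ, ‖q ζ‖ ∂μ := by
  obtain ⟨ρ, hρ, hclG, κ, hκ, hle⟩ :=
    hμ.exists_sphere_le_norm_cauchyWeight hG hb hconn ha hz₀
  obtain ⟨C, hC, hbound⟩ := hμ.exists_norm_mul_norm_cauchyWeight_le hG hb (isCompact_sphere z₀ ρ)
    (sphere_subset_closedBall.trans hclG)
  have hballG : ball z₀ ρ ⊆ G := ball_subset_closedBall.trans hclG
  refine ⟨ρ, hρ, C / κ, by positivity, hballG, fun z hz q hq => ?_⟩
  refine Complex.norm_le_of_forall_mem_frontier_norm_le isBounded_ball (hq.mono hballG) ?_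
    (subset_closure hz)
  rw [frontier_ball _ hρ.ne']
  intro w hw
  rw [div_mul_eq_mul_div, le_div_iff₀ hκ]
  exact (mul_le_mul_of_nonneg_left (hle w hw) (norm_nonneg _)).trans (hbound w hw q hq)

/-- Point evaluations being bounded for the `L¹` norm, apply this bound to all powers of `q n`. -/
theorem le_of_tendsto_norm (hμ : IsHarmonicMeasure G a μ) (hG : IsOpen G)
    (hb : Bornology.IsBounded G) (hconn : IsPreconnected G) (ha : a ∈ G) {z : ℂ} (hz : z ∈ G)
    {q : ℕ → ℂ → ℂ} (hq : ∀ n, DiffContOnCl ℂ (q n) G) {B C L : ℝ}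
    (hB : ∀ n, ∀ ζ ∈ frontier G, ‖q n ζ‖ ≤ B) {g : ℂ → ℝ}
    (hg : ∀ᵐ ζ ∂μ, Tendsto (fun n => ‖q n ζ‖) atTop (𝓝 (g ζ))) (hgC : ∀ᵐ ζ ∂μ, g ζ ≤ C)
    (hL : Tendsto (fun n => ‖q n z‖) atTop (𝓝 L)) : L ≤ C := by
  have := hμ.isProbabilityMeasure
  obtain ⟨ρ, hρ, M, hM, -, hle⟩ := hμ.exists_norm_le_integral_norm hG hb hconn ha hz
  have hg0 : ∀ᵐ ζ ∂μ, 0 ≤ g ζ := hg.mono fun ζ hζ => ge_of_tendsto' hζ fun n => norm_nonneg _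
  obtain ⟨ζ₀, h0, h1⟩ := (hg0.and hgC).exists
  refine le_of_forall_pow_le_mul_pow (M := M) (h0.trans h1) fun N => ?_
  have hqN : ∀ n, DiffContOnCl ℂ (fun w => q n w ^ N) G := fun n =>
    ⟨(hq n).differentiableOn.pow N, (hq n).continuousOn.pow N⟩
  have hlim : Tendsto (fun n => ∫ ζ, ‖q n ζ ^ N‖ ∂μ) atTop (𝓝 (∫ ζ, g ζ ^ N ∂μ)) := by
    refine tendsto_integral_of_dominated_convergence (fun _ => B ^ N) (fun n => ?_)
      (integrable_const _) (fun n => ?_) ?_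
    · exact (hμ.integrable_of_continuousOn hb
        ((hqN n).continuousOn.mono frontier_subset_closure)).norm.aestronglyMeasurable
    · filter_upwards [hμ.ae_mem_frontier] with ζ hζ
      rw [norm_norm, norm_pow]
      exact pow_le_pow_left₀ (norm_nonneg _) (hB n ζ hζ) N
    · filter_upwards [hg] with ζ hζ
      simpa only [norm_pow] using hζ.pow N
  calc L ^ N ≤ M * ∫ ζ, g ζ ^ N ∂μ := by
        refine le_of_tendsto_of_tendsto' (hL.pow N) (hlim.const_mul M) fun n => ?_
        simpa only [norm_pow] using hle z (mem_ball_self hρ) _ (hqN n)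
    _ ≤ M * ∫ _, C ^ N ∂μ := by
        refine mul_le_mul_of_nonneg_left (integral_mono_of_nonneg ?_ (integrable_const _) ?_) hM.le
        · exact hg0.mono fun ζ hζ => pow_nonneg hζ N
        · filter_upwards [hg0, hgC] with ζ hζ0 hζC
          exact pow_le_pow_left₀ hζ0 hζC N
    _ = M * C ^ N := by simp

end IsHarmonicMeasure

/-! ### Approximation by rational functions -/

theorem diffContOnCl_of_mem_ratFunctions {K G : Set ℂ} (hGK : closure G ⊆ K) {q : ℂ → ℂ}
    (hq : q ∈ ratFunctions K) : DiffContOnCl ℂ q G := by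
  obtain ⟨p, d, hd, rfl⟩ := hq
  have hdiff : DifferentiableOn ℂ (fun z => p.eval z / d.eval z) (closure G) := fun z hz =>
    (p.differentiableAt.div d.differentiableAt (hd z (hGK hz))).differentiableWithinAt
  exact ⟨hdiff.mono subset_closure, hdiff.continuousOn⟩

theorem measurable_of_mem_ratFunctions {K : Set ℂ} {q : ℂ → ℂ} (hq : q ∈ ratFunctions K) :
    Measurable q := by
  obtain ⟨p, d, -, rfl⟩ := hq
  exact p.continuous.measurable.div d.continuous.measurable

theorem exists_norm_le_of_mem_ratFunctions {K : Set ℂ} (hK : IsCompact K) {q : ℂ → ℂ}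
    (hq : q ∈ ratFunctions K) : ∃ C, ∀ z ∈ K, ‖q z‖ ≤ C := by
  obtain ⟨p, d, hd, rfl⟩ := hq
  exact hK.exists_bound_of_continuousOn (p.continuous.continuousOn.div d.continuous.continuousOn hd)

theorem memLp_of_mem_ratFunctions {K : Set ℂ} (hK : IsCompact K) {q : ℂ → ℂ}
    (hq : q ∈ ratFunctions K) {ω : Measure ℂ} [IsFiniteMeasure ω] (hω : ∀ᵐ z ∂ω, z ∈ K)
    (t : ℝ≥0∞) : MemLp q t ω := by
  obtain ⟨C, hC⟩ := exists_norm_le_of_mem_ratFunctions hK hq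
  exact MemLp.of_bound (measurable_of_mem_ratFunctions hq).aestronglyMeasurable C (hω.mono hC)

theorem integral_norm_le_toReal_eLpNorm {α E : Type*} [MeasurableSpace α] [NormedAddCommGroup E]
    {μ ω : Measure α} [IsProbabilityMeasure μ] (hle : μ ≤ ω) {t : ℝ≥0∞} (ht : 1 ≤ t) {f : α → E}
    (hf : MemLp f t ω) : ∫ ζ, ‖f ζ‖ ∂μ ≤ (eLpNorm f t ω).toReal := by
  have hfμ := (hf.mono_measure hle).aestronglyMeasurable
  rw [integral_norm_eq_lintegral_enorm hfμ, ← eLpNorm_one_eq_lintegral_enorm]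
  exact ENNReal.toReal_mono hf.eLpNorm_lt_top.ne
    ((eLpNorm_le_eLpNorm_of_exponent_le ht hfμ).trans (eLpNorm_mono_measure f hle))

/-- The filter of convergence of rational functions to `f` in `L^t(ω)`. By definition
`evalMap K t ω f z` is the limit of `q z` along it. -/
def approxFilter (K : Set ℂ) (t : ℝ≥0∞) (ω : Measure ℂ) (f : ℂ → ℂ) : Filter (ratFunctions K) :=
  comap (fun q => eLpNorm (fun w => f w - q.1 w) t ω) (𝓝 0)

section Approximation

variable {K G : Set ℂ} {t : ℝ≥0∞} [Fact (1 ≤ t)] {ω μ : Measure ℂ} {a : ℂ}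

theorem neBot_approxFilter {f : Lp ℂ t ω} (hf : f ∈ rationalLp K t ω) :
    (approxFilter K t ω f).NeBot := by
  refine comap_neBot_iff.2 fun s hs => ?_
  obtain ⟨ε, hε, hεs⟩ := ENNReal.nhds_zero_basis.mem_iff.1 hs
  obtain ⟨g, ⟨q, hq, hgq⟩, hlt⟩ := EMetric.mem_closure_iff.1 hf ε hε
  refine ⟨⟨q, hq⟩, hεs ?_⟩
  rw [Lp.edist_def] at hlt
  refine (eLpNorm_congr_ae ?_).trans_lt hlt
  filter_upwards [hgq] with w hw
  simp [hw]

theorem tendsto_integral_mul_approxFilter [IsFiniteMeasure ω] [IsProbabilityMeasure μ]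
    (hK : IsCompact K) (hω : ∀ᵐ z ∂ω, z ∈ K) (hle : μ ≤ ω) {f : ℂ → ℂ} (hf : MemLp f t ω)
    {g : ℂ → ℂ} (hg : AEStronglyMeasurable g μ) {C : ℝ} (hgC : ∀ᵐ ζ ∂μ, ‖g ζ‖ ≤ C) :
    Tendsto (fun q : ratFunctions K => ∫ ζ, q.1 ζ * g ζ ∂μ) (approxFilter K t ω f)
      (𝓝 (∫ ζ, f ζ * g ζ ∂μ)) := by
  have ht : 1 ≤ t := Fact.out
  have hQ : ∀ q : ratFunctions K, MemLp q.1 t ω := fun q => memLp_of_mem_ratFunctions hK q.2 hω t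
  have hint : ∀ {u : ℂ → ℂ}, MemLp u t ω → Integrable u μ := fun hu =>
    (hu.mono_measure hle).integrable ht
  have hC0 : 0 ≤ C := by
    obtain ⟨ζ, hζ⟩ := hgC.exists
    exact (norm_nonneg _).trans hζ
  have hlim : Tendsto (fun q : ratFunctions K => C * (eLpNorm (fun w => f w - q.1 w) t ω).toReal)
      (approxFilter K t ω f) (𝓝 0) := by
    have hcomap : Tendsto (fun q : ratFunctions K => eLpNorm (fun w => f w - q.1 w) t ω)
        (approxFilter K t ω f) (𝓝 0) := tendsto_comap
    simpa using ((ENNReal.tendsto_toReal ENNReal.zero_ne_top).comp hcomap).const_mul C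
  refine tendsto_iff_norm_sub_tendsto_zero.2
    (squeeze_zero (fun _ => norm_nonneg _) (fun q => ?_) hlim)
  have hsub : MemLp (fun w => f w - q.1 w) t ω := hf.sub (hQ q)
  rw [norm_sub_rev, ← integral_sub ((hint hf).mul_bdd hg hgC) ((hint (hQ q)).mul_bdd hg hgC)]
  calc ‖∫ ζ, (f ζ * g ζ - q.1 ζ * g ζ) ∂μ‖ ≤ ∫ ζ, C * ‖f ζ - q.1 ζ‖ ∂μ := by
        refine norm_integral_le_of_norm_le ((hint hsub).norm.const_mul C) ?_
        filter_upwards [hgC] with ζ hζ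
        rw [← sub_mul, norm_mul, mul_comm]
        gcongr
    _ ≤ C * (eLpNorm (fun w => f w - q.1 w) t ω).toReal := by
        rw [integral_const_mul]
        exact mul_le_mul_of_nonneg_left (integral_norm_le_toReal_eLpNorm hle ht hsub) hC0

namespace IsHarmonicMeasure

theorem tendsto_eval_approxFilter [IsFiniteMeasure ω] (hμ : IsHarmonicMeasure G a μ)
    (hG : IsOpen G) (hK : IsCompact K) (hGK : closure G ⊆ K) (hω : ∀ᵐ z ∂ω, z ∈ K) (hle : μ ≤ ω)
    {f : ℂ → ℂ} (hf : MemLp f t ω) :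
    Tendsto (fun q : ratFunctions K => q.1 a) (approxFilter K t ω f) (𝓝 (∫ ζ, f ζ ∂μ)) := by
  have := hμ.isProbabilityMeasure
  have hlim := tendsto_integral_mul_approxFilter hK hω hle hf (g := fun _ => 1)
    aestronglyMeasurable_const (C := 1) (by simp)
  simp only [mul_one] at hlim
  exact hlim.congr fun q => hμ.integral_eq_of_diffContOnCl hG
    (hK.isBounded.subset (subset_closure.trans hGK)) (diffContOnCl_of_mem_ratFunctions hGK q.2)

theorem integral_mul_of_mem_ratFunctions [IsFiniteMeasure ω] (hμ : IsHarmonicMeasure G a μ)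
    (hG : IsOpen G) (hK : IsCompact K) (hGK : closure G ⊆ K) (hω : ∀ᵐ z ∂ω, z ∈ K) (hle : μ ≤ ω)
    {f : Lp ℂ t ω} (hf : f ∈ rationalLp K t ω) {k : ℂ → ℂ} (hk : k ∈ ratFunctions K) :
    ∫ ζ, f ζ * k ζ ∂μ = (∫ ζ, f ζ ∂μ) * k a := by
  have := hμ.isProbabilityMeasure
  have := neBot_approxFilter hf
  have hD : ∀ q ∈ ratFunctions K, DiffContOnCl ℂ q G := fun q =>
    diffContOnCl_of_mem_ratFunctions hGK
  obtain ⟨C, hC⟩ := exists_norm_le_of_mem_ratFunctions hK hk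
  have hμK : ∀ᵐ ζ ∂μ, ζ ∈ K := ae_mono hle hω
  refine tendsto_nhds_unique (tendsto_integral_mul_approxFilter hK hω hle (Lp.memLp f)
    (measurable_of_mem_ratFunctions hk).aestronglyMeasurable (hμK.mono hC)) ?_
  refine ((hμ.tendsto_eval_approxFilter hG hK hGK hω hle (Lp.memLp f)).mul_const (k a)).congr ?_
  exact fun q => (hμ.integral_eq_of_diffContOnCl hG
    (hK.isBounded.subset (subset_closure.trans hGK)) ((hD q q.2).smul (hD k hk))).symm

theorem integral_mul_of_mem_rationalLp [IsFiniteMeasure ω] (hμ : IsHarmonicMeasure G a μ)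
    (hG : IsOpen G) (hK : IsCompact K) (hGK : closure G ⊆ K) (hω : ∀ᵐ z ∂ω, z ∈ K) (hle : μ ≤ ω)
    {f g : Lp ℂ t ω} (hf : f ∈ rationalLp K t ω) (hg : g ∈ rationalLp K t ω) {C : ℝ}
    (hgC : ∀ᵐ ζ ∂μ, ‖g ζ‖ ≤ C) : ∫ ζ, f ζ * g ζ ∂μ = (∫ ζ, f ζ ∂μ) * ∫ ζ, g ζ ∂μ := by
  have := hμ.isProbabilityMeasure
  have := neBot_approxFilter hf
  refine tendsto_nhds_unique (tendsto_integral_mul_approxFilter hK hω hle (Lp.memLp f)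
    ((Lp.memLp g).mono_measure hle).aestronglyMeasurable hgC) ?_
  refine ((hμ.tendsto_eval_approxFilter hG hK hGK hω hle (Lp.memLp f)).mul_const _).congr
    fun q => ?_
  rw [mul_comm, ← hμ.integral_mul_of_mem_ratFunctions hG hK hGK hω hle hg q.2]
  simp only [mul_comm]

theorem measure_eq_zero_or_compl_eq_zero [IsFiniteMeasure ω] (hμ : IsHarmonicMeasure G a μ)
    (hG : IsOpen G) (hK : IsCompact K) (hGK : closure G ⊆ K) (hω : ∀ᵐ z ∂ω, z ∈ K) (hle : μ ≤ ω)
    {A : Set ℂ} (hA : MeasurableSet A) {f : Lp ℂ t ω} (hf : f ∈ rationalLp K t ω)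
    (hfA : f =ᵐ[ω] A.indicator fun _ => (1 : ℂ)) : μ A = 0 ∨ μ Aᶜ = 0 := by
  have := hμ.isProbabilityMeasure
  have hfA : f =ᵐ[μ] A.indicator fun _ => (1 : ℂ) := ae_mono hle hfA
  have hint : ∫ ζ, f ζ ∂μ = μ.real A := by
    rw [integral_congr_ae hfA, integral_indicator hA, setIntegral_const]
    simp
  have hsq : ∫ ζ, f ζ * f ζ ∂μ = ∫ ζ, f ζ ∂μ := by
    refine integral_congr_ae ?_
    filter_upwards [hfA] with ζ hζ
    by_cases h : ζ ∈ A <;> simp [hζ, h]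
  have hbdd : ∀ᵐ ζ ∂μ, ‖f ζ‖ ≤ 1 := by
    filter_upwards [hfA] with ζ hζ
    by_cases h : ζ ∈ A <;> simp [hζ, h]
  have hidem : μ.real A * μ.real A = μ.real A := by
    have := hμ.integral_mul_of_mem_rationalLp hG hK hGK hω hle hf hf hbdd
    rw [hsq, hint] at this
    exact_mod_cast this.symm
  rcases IsIdempotentElem.iff_eq_zero_or_one.1 hidem with h | h
  · exact Or.inl ((measureReal_eq_zero_iff (measure_ne_top μ A)).1 h)
  · refine Or.inr ((prob_compl_eq_zero_iff hA).2 ?_)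
    rwa [measureReal_def, ENNReal.toReal_eq_one_iff] at h

theorem subset_abpe [IsFiniteMeasure ω] (hμ : IsHarmonicMeasure G a μ) (hG : IsOpen G)
    (hconn : IsPreconnected G) (ha : a ∈ G) (hK : IsCompact K) (hGK : closure G ⊆ K)
    (hω : ∀ᵐ z ∂ω, z ∈ K) (hle : μ ≤ ω) : G ⊆ abpe K t ω := by
  have := hμ.isProbabilityMeasure
  have hlocal : ∀ z₀ ∈ G, ∃ ρ > 0, ∃ M > 0, ∀ z ∈ ball z₀ ρ, ∀ q ∈ ratFunctions K,
      ‖q z‖ ≤ M * (eLpNorm q t ω).toReal := by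
    intro z₀ hz₀
    obtain ⟨ρ, hρ, M, hM, -, hbound⟩ := hμ.exists_norm_le_integral_norm hG
      (hK.isBounded.subset (subset_closure.trans hGK)) hconn ha hz₀
    refine ⟨ρ, hρ, M, hM, fun z hz q hq => ?_⟩
    calc ‖q z‖ ≤ M * ∫ ζ, ‖q ζ‖ ∂μ := hbound z hz q (diffContOnCl_of_mem_ratFunctions hGK hq)
      _ ≤ M * (eLpNorm q t ω).toReal := mul_le_mul_of_nonneg_left
          (integral_norm_le_toReal_eLpNorm hle Fact.out (memLp_of_mem_ratFunctions hK hq hω t))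
          hM.le
  have hbpe : G ⊆ bpe K t ω := fun z hz =>
    have ⟨_, hρ, M, _, hbound⟩ := hlocal z hz
    ⟨hGK (subset_closure hz), M, hbound z (mem_ball_self hρ)⟩
  exact fun z hz => ⟨interior_maximal hbpe hG hz, hlocal z hz⟩

end IsHarmonicMeasure

end Approximation

/-! ### Point evaluations in half-plane domains -/

/-- The difference of the Cauchy kernels at a point and at its conjugate. If `z` lies in a
half-plane domain, it represents the same functional on analytic functions as the Cauchy kernel at
`z`, but decays like a Poisson kernel. -/
def reflectedKernel (z ζ : ℂ) : ℂ := (ζ - z)⁻¹ - (ζ - starRingEnd ℂ z)⁻¹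

theorem mul_reflectedKernel (a z ζ : ℂ) : (ζ - a) * reflectedKernel z ζ =
    cauchyKernel a z ζ - cauchyKernel a (starRingEnd ℂ z) ζ :=
  mul_sub _ _ _

theorem measurable_reflectedKernel (z : ℂ) : Measurable (reflectedKernel z) := by
  unfold reflectedKernel
  fun_prop

namespace IsHalfPlaneDomain

variable {G : Set ℂ} {σ : ℝ} {a z : ℂ} {μ : Measure ℂ}

theorem conj_notMem_closure (hG : IsHalfPlaneDomain σ G) (hz : z ∈ G) :
    starRingEnd ℂ z ∉ closure G := by
  intro h
  have hconj := mul_im_nonneg_of_mem_closure hG.subset_halfPlane h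
  have hpos : 0 < σ * z.im := hG.subset_halfPlane hz
  rw [Complex.conj_im] at hconj
  linarith

theorem conj_notMem_frontier (hG : IsHalfPlaneDomain σ G) (hz : z ∈ G) :
    starRingEnd ℂ z ∉ frontier G := fun h =>
  hG.conj_notMem_closure hz (frontier_subset_closure h)

theorem mul_cauchyWeight (hG : IsHalfPlaneDomain σ G) (hμ : IsHarmonicMeasure G a μ) (hz : z ∈ G)
    {q : ℂ → ℂ} (hq : DiffContOnCl ℂ q G) :
    q z * cauchyWeight μ a z = ∫ ζ, q ζ * ((ζ - a) * reflectedKernel z ζ) ∂μ := by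
  have hqf := hq.continuousOn.mono frontier_subset_closure
  simp only [mul_reflectedKernel, mul_sub]
  rw [integral_sub (hμ.integrable_mul_cauchyKernel hG.isBounded hqf
      (notMem_frontier_of_mem hG.isOpen hz))
    (hμ.integrable_mul_cauchyKernel hG.isBounded hqf (hG.conj_notMem_frontier hz)),
    hμ.integral_mul_cauchyKernel_eq_zero hG.isOpen hG.isBounded hq (hG.conj_notMem_closure hz),
    sub_zero, hμ.mul_cauchyWeight hG.isOpen hG.isBounded hq hz]

theorem cauchyWeight_eq (hG : IsHalfPlaneDomain σ G) (hμ : IsHarmonicMeasure G a μ) (hz : z ∈ G) :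
    cauchyWeight μ a z = ∫ ζ, (ζ - a) * reflectedKernel z ζ ∂μ := by
  simpa using hG.mul_cauchyWeight hμ hz (q := fun _ => 1) diffContOnCl_const

theorem continuousOn_reflectedKernel (hG : IsHalfPlaneDomain σ G) (hz : z ∈ G) :
    ContinuousOn (reflectedKernel z) (frontier G) :=
  ((continuous_sub_right z).continuousOn.inv₀ fun _ hζ =>
      sub_ne_zero.2 (ne_of_mem_of_not_mem hζ (notMem_frontier_of_mem hG.isOpen hz))).sub
    ((continuous_sub_right _).continuousOn.inv₀ fun _ hζ =>
      sub_ne_zero.2 (ne_of_mem_of_not_mem hζ (hG.conj_notMem_frontier hz)))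

theorem integrable_mul_reflectedKernel (hG : IsHalfPlaneDomain σ G) (hz : z ∈ G)
    (hμ : ∀ᵐ ζ ∂μ, ζ ∈ frontier G) {g : ℂ → ℂ} (hg : Integrable g μ) :
    Integrable (fun ζ => g ζ * reflectedKernel z ζ) μ := by
  obtain ⟨C, hC⟩ := (isCompact_frontier hG.isBounded).exists_bound_of_continuousOn
    (hG.continuousOn_reflectedKernel hz)
  exact hg.mul_bdd (measurable_reflectedKernel z).aestronglyMeasurable (hμ.mono hC)

theorem evalMap_eq {K : Set ℂ} {t : ℝ≥0∞} [Fact (1 ≤ t)] {ω : Measure ℂ} [IsFiniteMeasure ω]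
    (hG : IsHalfPlaneDomain σ G) (hμ : IsHarmonicMeasure G a μ) (hK : IsCompact K)
    (hGK : closure G ⊆ K) (hω : ∀ᵐ z ∂ω, z ∈ K) (hle : μ ≤ ω) (hz : z ∈ G)
    (hw : cauchyWeight μ a z ≠ 0) {f : Lp ℂ t ω} (hf : f ∈ rationalLp K t ω) :
    evalMap K t ω f z = (∫ ζ, f ζ * ((ζ - a) * reflectedKernel z ζ) ∂μ) / cauchyWeight μ a z := by
  have := hμ.isProbabilityMeasure
  have := neBot_approxFilter hf
  obtain ⟨C, hC⟩ := (isCompact_frontier hG.isBounded).exists_bound_of_continuousOn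
    ((continuous_sub_right a).continuousOn.mul (hG.continuousOn_reflectedKernel hz))
  have hmeas : Measurable fun ζ => (ζ - a) * reflectedKernel z ζ :=
    (measurable_id.sub_const a).mul (measurable_reflectedKernel z)
  refine Tendsto.limUnder_eq (f := approxFilter K t ω f) ?_
  refine ((tendsto_integral_mul_approxFilter hK hω hle (Lp.memLp f)
    hmeas.aestronglyMeasurable (hμ.ae_mem_frontier.mono hC)).div_const _).congr fun q => ?_
  rw [← hG.mul_cauchyWeight hμ hz (diffContOnCl_of_mem_ratFunctions hGK q.2),
    mul_div_cancel_right₀ _ hw]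

end IsHalfPlaneDomain

/-! ### Averages against radial kernels -/

section RadialKernel

variable {X : Type*} [PseudoMetricSpace X]

/-- A radial majorant of the Poisson kernel of a half plane at height `y` above the boundary point
`x`. -/
def radialKernel (x : X) (y : ℝ) (ζ : X) : ℝ := y / (dist ζ x + y) ^ 2

theorem radialKernel_le_of_two_pow_mul_le {x ζ : X} {y : ℝ} (hy : 0 < y) {k : ℕ}
    (h : 2 ^ k * y ≤ dist ζ x + y) : radialKernel x y ζ ≤ (1 / 4) ^ k / y := by
  calc y / (dist ζ x + y) ^ 2 ≤ y / (2 ^ k * y) ^ 2 := by gcongr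
    _ = (1 / 4) ^ k / y := by
      rw [show (4 : ℝ) = 2 ^ 2 by norm_num, one_div_pow, ← pow_mul, mul_comm 2 k, pow_mul]
      field_simp

theorem ofReal_radialKernel_le_tsum (x : X) {y : ℝ} (hy : 0 < y) (ζ : X) :
    ENNReal.ofReal (radialKernel x y ζ) ≤ ∑' k : ℕ, (closedBall x (2 ^ k * y)).indicator
      (fun _ => ENNReal.ofReal (4 * (1 / 4) ^ k / y)) ζ := by
  have hone : 1 ≤ dist ζ x / y + 1 := le_add_of_nonneg_left (by positivity)
  obtain ⟨k, hk, hk'⟩ := exists_nat_pow_near hone one_lt_two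
  have hmem : ζ ∈ closedBall x (2 ^ (k + 1) * y) :=
    (div_le_iff₀ hy).1 ((le_add_of_nonneg_right zero_le_one).trans hk'.le)
  refine le_trans ?_ (ENNReal.le_tsum (k + 1))
  rw [indicator_of_mem hmem, pow_succ (1 / 4 : ℝ), ← mul_assoc, mul_right_comm,
    show (4 : ℝ) * (1 / 4) = 1 by norm_num, one_mul]
  refine ENNReal.ofReal_le_ofReal (radialKernel_le_of_two_pow_mul_le hy ?_)
  calc 2 ^ k * y ≤ (dist ζ x / y + 1) * y := by gcongr
    _ = dist ζ x + y := by field_simp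

variable [MeasurableSpace X]

/-- The measure `ν` has density `D` at `x` with respect to length: `ν (closedBall x s) ~ D * s` as
`s → 0`. -/
def HasLinearDensityAt (ν : Measure X) (x : X) (D : ℝ≥0∞) : Prop :=
  Tendsto (fun s : ℝ => ν (closedBall x s) / ENNReal.ofReal s) (𝓝[>] 0) (𝓝 D)

theorem HasLinearDensityAt.exists_measure_closedBall_le {ν : Measure X} [IsFiniteMeasure ν] {x : X}
    {D : ℝ≥0∞} (h : HasLinearDensityAt ν x D) (hD : D ≠ ∞) :
    ∃ C ≠ ∞, ∀ s : ℝ, 0 < s → ν (closedBall x s) ≤ C * ENNReal.ofReal s := by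
  obtain ⟨R, hR, hsmall⟩ := mem_nhdsGT_iff_exists_Ioo_subset.1
    (h.eventually_lt_const (ENNReal.lt_add_right hD one_ne_zero))
  have hR : ENNReal.ofReal R ≠ 0 := by simpa using hR
  refine ⟨max (D + 1) (ν univ / ENNReal.ofReal R), ?_, fun s hs => ?_⟩
  · simp [hD, ENNReal.div_eq_top, hR]
  · have hs' : ENNReal.ofReal s ≠ 0 := by simpa using hs
    rcases lt_or_ge s R with hsR | hsR
    · refine (ENNReal.div_le_iff hs' ENNReal.ofReal_ne_top).1 ?_
      exact (hsmall ⟨hs, hsR⟩).le.trans (le_max_left _ _)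
    · calc ν (closedBall x s) ≤ ν univ := measure_mono (subset_univ _)
        _ = ν univ / ENNReal.ofReal R * ENNReal.ofReal R :=
          (ENNReal.div_mul_cancel hR ENNReal.ofReal_ne_top).symm
        _ ≤ max (D + 1) (ν univ / ENNReal.ofReal R) * ENNReal.ofReal s := by
          gcongr
          exact le_max_right _ _

variable [OpensMeasurableSpace X]

theorem measurable_radialKernel (x : X) (y : ℝ) : Measurable (radialKernel x y) := by
  unfold radialKernel
  fun_prop

theorem lintegral_radialKernel_le_tsum (ν : Measure X) (x : X) {y : ℝ} (hy : 0 < y) :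
    ∫⁻ ζ, ENNReal.ofReal (radialKernel x y ζ) ∂ν ≤ ∑' k : ℕ, ENNReal.ofReal (4 * (1 / 2) ^ k) *
      (ν (closedBall x (2 ^ k * y)) / ENNReal.ofReal (2 ^ k * y)) := by
  refine (lintegral_mono fun ζ => ofReal_radialKernel_le_tsum x hy ζ).trans_eq ?_
  rw [lintegral_tsum fun k => (measurable_const.indicator measurableSet_closedBall).aemeasurable]
  congr 1 with k
  have hpow : (4 : ℝ) * (1 / 4) ^ k / y = 4 * (1 / 2) ^ k / (2 ^ k * y) := by
    rw [show (1 / 4 : ℝ) = (1 / 2) * (1 / 2) by norm_num, mul_pow]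
    simp only [one_div_pow]
    field_simp
  rw [lintegral_indicator_const measurableSet_closedBall, hpow,
    ENNReal.ofReal_div_of_pos (by positivity), ENNReal.mul_comm_div]

variable {ν : Measure X} {x : X}

theorem tendsto_lintegral_radialKernel (h : HasLinearDensityAt ν x 0) {C : ℝ≥0∞} (hC : C ≠ ∞)
    (hle : ∀ s : ℝ, 0 < s → ν (closedBall x s) ≤ C * ENNReal.ofReal s) :
    Tendsto (fun y => ∫⁻ ζ, ENNReal.ofReal (radialKernel x y ζ) ∂ν) (𝓝[>] 0) (𝓝 0) := by
  set F : ℝ → ℕ → ℝ≥0∞ := fun y k => ENNReal.ofReal (4 * (1 / 2) ^ k) *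
    (ν (closedBall x (2 ^ k * y)) / ENNReal.ofReal (2 ^ k * y))
  have hFbound : ∀ᶠ y in 𝓝[>] 0, ∀ k, F y k ≤ ENNReal.ofReal (4 * (1 / 2) ^ k) * C := by
    filter_upwards [self_mem_nhdsWithin] with y (hy : 0 < y) k
    have hky : 0 < 2 ^ k * y := by positivity
    refine mul_le_mul_right ?_ _
    exact (ENNReal.div_le_iff (by simpa using hky) ENNReal.ofReal_ne_top).2 (hle _ hky)
  have hbound : ∫⁻ k, ENNReal.ofReal (4 * (1 / 2) ^ k) * C ∂Measure.count ≠ ∞ := by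
    rw [lintegral_count, ENNReal.tsum_mul_right]
    exact ENNReal.mul_ne_top (summable_geometric_two.mul_left 4).tsum_ofReal_ne_top hC
  have hFlim : ∀ k, Tendsto (F · k) (𝓝[>] 0) (𝓝 0) := fun k => by
    have hscale : Tendsto (fun y : ℝ => 2 ^ k * y) (𝓝[>] 0) (𝓝[>] 0) := by
      refine tendsto_nhdsWithin_iff.2 ⟨?_, ?_⟩
      · simpa using ((continuous_const_mul (2 ^ k : ℝ)).tendsto 0).mono_left nhdsWithin_le_nhds
      · filter_upwards [self_mem_nhdsWithin] with y (hy : 0 < y)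
        exact mem_Ioi.2 (by positivity)
    have := ENNReal.Tendsto.const_mul (a := ENNReal.ofReal (4 * (1 / 2) ^ k)) (h.comp hscale)
      (Or.inr ENNReal.ofReal_ne_top)
    rwa [mul_zero] at this
  have hlim : Tendsto (fun y => ∑' k, F y k) (𝓝[>] 0) (𝓝 0) := by
    have := tendsto_lintegral_filter_of_dominated_convergence (μ := Measure.count) _
      (Eventually.of_forall fun y => (measurable_of_countable (F y)))
      (hFbound.mono fun y hy => ae_of_all _ hy) hbound (ae_of_all _ hFlim)
    simpa only [lintegral_count, tsum_zero] using this
  refine tendsto_of_tendsto_of_tendsto_of_le_of_le' tendsto_const_nhds hlim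
    (Eventually.of_forall fun _ => zero_le) ?_
  filter_upwards [self_mem_nhdsWithin] with y hy using lintegral_radialKernel_le_tsum ν x hy

theorem tendsto_integral_of_enorm_le_radialKernel {ι E : Type*} [NormedAddCommGroup E]
    [NormedSpace ℝ E] {l : Filter ι} {Y : ι → ℝ} {g : ι → X → E} {μ : Measure X} {w : X → ℝ≥0∞}
    (hw : AEMeasurable w μ) (h : HasLinearDensityAt (μ.withDensity w) x 0) {B C : ℝ≥0∞}
    (hB : B ≠ ∞) (hle : ∀ s : ℝ, 0 < s → μ.withDensity w (closedBall x s) ≤ B * ENNReal.ofReal s)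
    (hY : Tendsto Y l (𝓝[>] 0)) (hC : C ≠ ∞)
    (hg : ∀ᶠ i in l, ∀ᵐ ζ ∂μ, ‖g i ζ‖ₑ ≤ C * (w ζ * ENNReal.ofReal (radialKernel x (Y i) ζ))) :
    Tendsto (fun i => ∫ ζ, g i ζ ∂μ) l (𝓝 0) := by
  have hlim : Tendsto (fun i => C *
      ∫⁻ ζ, ENNReal.ofReal (radialKernel x (Y i) ζ) ∂μ.withDensity w) l (𝓝 0) := by
    simpa using ENNReal.Tendsto.const_mul ((tendsto_lintegral_radialKernel h hB hle).comp hY)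
      (Or.inr hC)
  rw [tendsto_zero_iff_enorm_tendsto_zero]
  refine tendsto_of_tendsto_of_tendsto_of_le_of_le' tendsto_const_nhds hlim
    (Eventually.of_forall fun _ => zero_le) ?_
  filter_upwards [hg] with i hi
  rw [lintegral_withDensity_eq_lintegral_mul₀ hw
    (measurable_radialKernel x (Y i)).ennreal_ofReal.aemeasurable, ← lintegral_const_mul' _ _ hC]
  exact (enorm_integral_le_lintegral_enorm _).trans (lintegral_mono_ae hi)

end RadialKernel

/-! ### The Poisson kernel of a half plane -/

section LinePoisson

/-- The Poisson kernel, times `π`, of the half plane containing `z`. It is used both for `ζ` on the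
real line and for other `ζ`. -/
def linePoisson (z ζ : ℂ) : ℝ := |z.im| / ‖ζ - z‖ ^ 2

theorem linePoisson_nonneg (z ζ : ℂ) : 0 ≤ linePoisson z ζ := by
  unfold linePoisson
  positivity

theorem linePoisson_ofReal (z : ℂ) (t : ℝ) :
    linePoisson z t = |z.im|⁻¹ * (1 + ((t - z.re) / |z.im|) ^ 2)⁻¹ := by
  rcases eq_or_ne z.im 0 with h | h
  · simp [linePoisson, h]
  · have := abs_pos.2 h
    rw [linePoisson, norm_sq_eq_re_sq_add_im_sq, Complex.sub_re, Complex.sub_im, Complex.ofReal_re,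
      Complex.ofReal_im, zero_sub, neg_sq, ← sq_abs z.im]
    field_simp
    ring

theorem integrable_linePoisson (z : ℂ) : Integrable fun t : ℝ => linePoisson z t := by
  simp only [linePoisson_ofReal]
  rcases eq_or_ne z.im 0 with h | h
  · simp [h]
  · exact ((integrable_inv_one_add_sq.comp_div (abs_pos.2 h).ne').comp_sub_right z.re).const_mul _

theorem integral_linePoisson {z : ℂ} (hz : z.im ≠ 0) : ∫ t : ℝ, linePoisson z t = Real.pi := by
  have h := abs_pos.2 hz
  simp only [linePoisson_ofReal]
  rw [integral_const_mul, integral_sub_right_eq_self (fun t => (1 + (t / |z.im|) ^ 2)⁻¹),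
    Measure.integral_comp_div (fun t => (1 + t ^ 2)⁻¹), integral_univ_inv_one_add_sq, abs_abs,
    smul_eq_mul, inv_mul_cancel_left₀ h.ne']

theorem setIntegral_linePoisson_mono (z : ℂ) {E F : Set ℝ} (h : E ≤ᵐ[volume] F) :
    ∫ t : ℝ in E, linePoisson z t ≤ ∫ t : ℝ in F, linePoisson z t :=
  setIntegral_mono_set (integrable_linePoisson z).integrableOn
    (ae_of_all _ fun t => linePoisson_nonneg z t) h

theorem setIntegral_linePoisson_le_pi (z : ℂ) (E : Set ℝ) :
    ∫ t : ℝ in E, linePoisson z t ≤ Real.pi := by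
  rcases eq_or_ne z.im 0 with h | h
  · simp [linePoisson, h, Real.pi_pos.le]
  · rw [← integral_linePoisson h]
    exact setIntegral_le_integral (integrable_linePoisson z)
      (ae_of_all _ fun t => linePoisson_nonneg z t)

theorem intervalIntegral_linePoisson {z : ℂ} (hz : z.im ≠ 0) (a b : ℝ) :
    ∫ t in a..b, linePoisson z t =
      Real.arctan ((b - z.re) / |z.im|) - Real.arctan ((a - z.re) / |z.im|) := by
  have h := abs_pos.2 hz
  simp only [linePoisson_ofReal]
  rw [intervalIntegral.integral_const_mul,
    intervalIntegral.integral_comp_sub_right (fun t => (1 + (t / |z.im|) ^ 2)⁻¹),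
    intervalIntegral.integral_comp_div (fun t => (1 + t ^ 2)⁻¹) h.ne', integral_inv_one_add_sq,
    smul_eq_mul, inv_mul_cancel_left₀ h.ne']

/-- Thales' theorem: a diameter is seen from the circle at a right angle. -/
theorem setIntegral_linePoisson_diameter {z : ℂ} (hz : z.im ≠ 0) {c ρ : ℝ} (h : ‖z - c‖ = ρ) :
    ∫ t : ℝ in Ioc (c - ρ) (c + ρ), linePoisson z t = Real.pi / 2 := by
  have hy := abs_pos.2 hz
  have hρ : 0 ≤ ρ := h ▸ norm_nonneg _
  have hcircle : (z.re - c) ^ 2 + |z.im| ^ 2 = ρ ^ 2 := by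
    rw [sq_abs, ← h, norm_sq_eq_re_sq_add_im_sq]
    simp
  have hlt : 0 < c + ρ - z.re := by
    have : z.re - c < ρ := lt_of_pow_lt_pow_left₀ 2 hρ (by nlinarith)
    linarith
  have hperp : (c - ρ - z.re) / |z.im| = -((c + ρ - z.re) / |z.im|)⁻¹ := by
    field_simp
    linarith
  rw [← intervalIntegral.integral_of_le (by linarith), intervalIntegral_linePoisson hz, hperp,
    Real.arctan_neg, Real.arctan_inv_of_pos (by positivity)]
  ring

theorem setIntegral_linePoisson_le_of_subset {z : ℂ} (hz : z.im ≠ 0) {c ρ : ℝ} (h : ‖z - c‖ = ρ)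
    {E : Set ℝ} (hE : E ⊆ Icc (c - ρ) (c + ρ)) :
    ∫ t : ℝ in E, linePoisson z t ≤ Real.pi / 2 := by
  rw [← setIntegral_linePoisson_diameter hz h]
  exact setIntegral_linePoisson_mono z (hE.eventuallyLE.trans Ioc_ae_eq_Icc.symm.le)

theorem setIntegral_linePoisson_le_of_disjoint {z : ℂ} (hz : z.im ≠ 0) {c ρ : ℝ} (h : ‖z - c‖ = ρ)
    {E : Set ℝ} (hE : Disjoint E (Ioo (c - ρ) (c + ρ))) :
    ∫ t : ℝ in E, linePoisson z t ≤ Real.pi / 2 := by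
  have hsum := integral_add_compl (s := Ioc (c - ρ) (c + ρ)) measurableSet_Ioc
    (integrable_linePoisson z)
  rw [setIntegral_linePoisson_diameter hz h, integral_linePoisson hz] at hsum
  have hsub : E ≤ᵐ[volume] (Ioc (c - ρ) (c + ρ))ᶜ :=
    (subset_compl_iff_disjoint_right.2 hE).eventuallyLE.trans Ioo_ae_eq_Ioc.compl.le
  calc ∫ t : ℝ in E, linePoisson z t ≤ ∫ t : ℝ in (Ioc (c - ρ) (c + ρ))ᶜ, linePoisson z t :=
        setIntegral_linePoisson_mono z hsub
    _ = Real.pi - Real.pi / 2 := eq_sub_of_add_eq' hsum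
    _ = Real.pi / 2 := sub_half _

end LinePoisson

/-! ### The Poisson kernel in cones -/

section Cone

variable {σ α x : ℝ}

theorem norm_sub_ofReal_le_of_mem_sideCone (hσ : |σ| = 1) {z : ℂ} (hα : 0 < α)
    (hz : z ∈ sideCone σ α x) : ‖z - x‖ ≤ (α + 1) * (σ * z.im) := by
  have him := mul_im_eq_abs_im hσ (sideCone_subset_halfPlane hα σ x hz).le
  have hre : |z.re - x| < α * (σ * z.im) := hz
  have := Complex.norm_le_abs_re_add_abs_im (z - x)
  simp only [Complex.sub_re, Complex.ofReal_re, Complex.sub_im, Complex.ofReal_im, sub_zero,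
    ← him] at this
  linarith

theorem linePoisson_le_radialKernel (hσ : |σ| = 1) (hα : 0 < α) {z ζ : ℂ}
    (hz : z ∈ sideCone σ α x) (hζ : σ * z.im / 2 ≤ ‖ζ - z‖) :
    linePoisson z ζ ≤ (2 * α + 5) ^ 2 * radialKernel (x : ℂ) (σ * z.im) ζ := by
  have hy : 0 < σ * z.im := sideCone_subset_halfPlane hα σ x hz
  have hdist : dist ζ x + σ * z.im ≤ (2 * α + 5) * ‖ζ - z‖ := by
    have htri := norm_sub_le_norm_sub_add_norm_sub ζ z x
    have hzx := norm_sub_ofReal_le_of_mem_sideCone hσ hα hz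
    rw [dist_eq_norm]
    nlinarith
  have hpos : 0 < ‖ζ - z‖ := (half_pos hy).trans_le hζ
  have : 0 < dist ζ x + σ * z.im := by positivity
  rw [linePoisson, radialKernel, ← mul_im_eq_abs_im hσ hy.le, ← mul_div_assoc,
    div_le_div_iff₀ (by positivity) (by positivity)]
  calc σ * z.im * (dist ζ x + σ * z.im) ^ 2 ≤ σ * z.im * ((2 * α + 5) * ‖ζ - z‖) ^ 2 := by gcongr
    _ = (2 * α + 5) ^ 2 * (σ * z.im) * ‖ζ - z‖ ^ 2 := by ring

theorem linePoisson_ofReal_le_radialKernel (hσ : |σ| = 1) (hα : 0 < α) {z : ℂ}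
    (hz : z ∈ sideCone σ α x) (t : ℝ) :
    linePoisson z t ≤ (2 * α + 5) ^ 2 * radialKernel x (σ * z.im) t := by
  have hy : 0 < σ * z.im := sideCone_subset_halfPlane hα σ x hz
  have hζ : σ * z.im / 2 ≤ ‖(t : ℂ) - z‖ := by
    have := Complex.abs_im_le_norm (z - t)
    rw [Complex.sub_im, Complex.ofReal_im, sub_zero, ← mul_im_eq_abs_im hσ hy.le,
      norm_sub_rev] at this
    linarith
  simpa only [radialKernel, Complex.isometry_ofReal.dist_eq] using
    linePoisson_le_radialKernel hσ hα hz hζ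

theorem tendsto_mul_im_sideCone (hα : 0 < α) :
    Tendsto (fun z : ℂ => σ * z.im) (𝓝[sideCone σ α x] (x : ℂ)) (𝓝[>] 0) := by
  refine tendsto_nhdsWithin_iff.2 ⟨?_, ?_⟩
  · have : Continuous fun z : ℂ => σ * z.im := by fun_prop
    simpa using (this.tendsto (x : ℂ)).mono_left nhdsWithin_le_nhds
  · filter_upwards [self_mem_nhdsWithin] with z hz using sideCone_subset_halfPlane hα σ x hz

theorem neBot_nhdsWithin_sideCone (hσ : |σ| = 1) (hα : 0 < α) :
    (𝓝[sideCone σ α x] (x : ℂ)).NeBot := by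
  have hpath : Continuous fun s : ℝ => (x + (σ * s : ℝ) * Complex.I : ℂ) := by fun_prop
  have hlim : Tendsto (fun s : ℝ => (x + (σ * s : ℝ) * Complex.I : ℂ)) (𝓝[>] 0)
      (𝓝[sideCone σ α x] (x : ℂ)) := by
    refine tendsto_nhdsWithin_iff.2 ⟨?_, ?_⟩
    · simpa using (hpath.tendsto 0).mono_left nhdsWithin_le_nhds
    · filter_upwards [self_mem_nhdsWithin] with s (hs : 0 < s)
      have hσσ : σ * σ = 1 := by rw [← abs_mul_abs_self, hσ, one_mul]
      simpa [sideCone, ← mul_assoc σ σ s, hσσ] using mul_pos hα hs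
  exact hlim.neBot

theorem tendsto_setIntegral_linePoisson (hσ : |σ| = 1) (hα : 0 < α) {E : Set ℝ}
    (hE : MeasurableSet E) (hx : HasLinearDensityAt (volume.restrict Eᶜ) x 0) :
    Tendsto (fun z => ∫ t : ℝ in E, linePoisson z t) (𝓝[sideCone σ α x] (x : ℂ)) (𝓝 Real.pi) := by
  have hgrowth : ∀ s : ℝ, 0 < s →
      (volume.restrict Eᶜ).withDensity 1 (closedBall x s) ≤ 2 * ENNReal.ofReal s := fun s _ => by
    rw [withDensity_one]
    refine (Measure.restrict_apply_le _ _).trans_eq ?_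
    rw [Real.volume_closedBall, ENNReal.ofReal_mul zero_le_two, ENNReal.ofReal_ofNat]
  have hcompl : Tendsto (fun z => ∫ t : ℝ in Eᶜ, linePoisson z t) (𝓝[sideCone σ α x] (x : ℂ))
      (𝓝 0) := by
    refine tendsto_integral_of_enorm_le_radialKernel (w := 1) aemeasurable_const
      (by rwa [withDensity_one]) ENNReal.ofNat_ne_top hgrowth (tendsto_mul_im_sideCone hα)
      (C := ENNReal.ofReal ((2 * α + 5) ^ 2)) ENNReal.ofReal_ne_top ?_
    filter_upwards [self_mem_nhdsWithin] with z hz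
    refine ae_of_all _ fun t => ?_
    rw [Pi.one_apply, one_mul, ← ENNReal.ofReal_mul (by positivity),
      Real.enorm_of_nonneg (linePoisson_nonneg z t)]
    exact ENNReal.ofReal_le_ofReal (linePoisson_ofReal_le_radialKernel hσ hα hz t)
  have hsub := hcompl.const_sub Real.pi
  rw [sub_zero] at hsub
  refine hsub.congr' ?_
  filter_upwards [self_mem_nhdsWithin] with z hz
  have him : z.im ≠ 0 := right_ne_zero_of_mul (sideCone_subset_halfPlane hα σ x hz).ne'
  rw [← integral_linePoisson him, ← integral_add_compl hE (integrable_linePoisson z),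
    add_sub_cancel_right]

end Cone

/-! ### Length is absolutely continuous with respect to harmonic measure -/

theorem ae_hasLinearDensityAt (ρ : Measure ℝ) [IsLocallyFiniteMeasure ρ] :
    ∀ᵐ x, HasLinearDensityAt ρ x (2 * ρ.rnDeriv volume x) := by
  filter_upwards [Besicovitch.ae_tendsto_rnDeriv ρ volume] with x hx
  refine (ENNReal.Tendsto.const_mul hx (Or.inr ENNReal.ofNat_ne_top)).congr fun s => ?_
  rw [Real.volume_closedBall, ENNReal.ofReal_mul zero_le_two, ENNReal.ofReal_ofNat,
    ← mul_div_assoc, ENNReal.mul_div_mul_left _ _ two_ne_zero ENNReal.ofNat_ne_top]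

theorem ae_hasLinearDensityAt_restrict_compl {E : Set ℝ} (hE : MeasurableSet E) :
    ∀ᵐ x, x ∈ E → HasLinearDensityAt (volume.restrict Eᶜ) x 0 := by
  filter_upwards [ae_hasLinearDensityAt (volume.restrict Eᶜ),
    Measure.rnDeriv_restrict_self volume hE.compl] with x hx hx' hxE
  rwa [hx', indicator_of_notMem (notMem_compl_iff.2 hxE), mul_zero] at hx

section LineCauchy

variable {E : Set ℝ} {σ : ℝ} {z : ℂ}

/-- The Cauchy transform of length on `E`. -/
def lineCauchy (E : Set ℝ) (z : ℂ) : ℂ := ∫ t : ℝ in E, ((t : ℂ) - z)⁻¹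

theorem differentiableAt_lineCauchy (hE : IsCompact E) (hz : z ∉ ((↑) : ℝ → ℂ) '' E) :
    DifferentiableAt ℂ (lineCauchy E) z := by
  unfold lineCauchy
  simpa only [one_mul] using differentiableAt_integral_mul_inv_sub (ν := volume.restrict E)
    (p := fun t : ℝ => (t : ℂ)) (g := fun _ => 1) (hE.image Complex.continuous_ofReal).isClosed
    Complex.continuous_ofReal.aestronglyMeasurable
    ((ae_restrict_mem hE.measurableSet).mono fun t ht => mem_image_of_mem _ ht)
    (integrableOn_const hE.measure_lt_top.ne) hz

theorem mul_im_lineCauchy (hE : IsCompact E) (hσ : |σ| = 1) (hz : 0 ≤ σ * z.im)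
    (hzE : z ∉ ((↑) : ℝ → ℂ) '' E) :
    σ * (lineCauchy E z).im = ∫ t : ℝ in E, linePoisson z t := by
  have hint : IntegrableOn (fun t : ℝ => ((t : ℂ) - z)⁻¹) E :=
    ContinuousOn.integrableOn_compact hE (ContinuousOn.inv₀ (by fun_prop) fun t ht =>
      sub_ne_zero.2 fun h => hzE (h ▸ mem_image_of_mem _ ht))
  have him := Complex.imCLM.integral_comp_comm hint
  simp only [Complex.imCLM_apply] at him
  rw [lineCauchy, ← him, ← integral_const_mul]
  congr 1 with t
  rw [linePoisson, ← mul_im_eq_abs_im hσ hz, Complex.inv_im, Complex.normSq_eq_norm_sq]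
  simp [mul_div_assoc]

theorem notMem_image_ofReal (hz : 0 < σ * z.im) : z ∉ ((↑) : ℝ → ℂ) '' E := by
  rintro ⟨t, -, rfl⟩
  simp at hz

/-- An analytic function in `halfPlane σ` whose modulus is the exponential of the Poisson integral
of `E`. -/
def lineExp (E : Set ℝ) (σ : ℝ) (z : ℂ) : ℂ := Complex.exp (-(σ * Complex.I * lineCauchy E z))

theorem differentiableAt_lineExp (hE : IsCompact E) (σ : ℝ) (hz : z ∉ ((↑) : ℝ → ℂ) '' E) :
    DifferentiableAt ℂ (lineExp E σ) z := by
  have := differentiableAt_lineCauchy hE hz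
  unfold lineExp
  fun_prop

theorem norm_lineExp (hE : IsCompact E) (hσ : |σ| = 1) (hz : 0 ≤ σ * z.im)
    (hzE : z ∉ ((↑) : ℝ → ℂ) '' E) :
    ‖lineExp E σ z‖ = Real.exp (∫ t : ℝ in E, linePoisson z t) := by
  rw [lineExp, Complex.norm_exp, ← mul_im_lineCauchy hE hσ hz hzE]
  simp

theorem mul_im_shift_pos (hσ : |σ| = 1) (hz : 0 ≤ σ * z.im) {s : ℝ} (hs : 0 < s) :
    0 < σ * (z + (σ * s : ℝ) * Complex.I).im := by
  have hσσ : σ * σ = 1 := by rw [← abs_mul_abs_self, hσ, one_mul]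
  simpa [mul_add, ← mul_assoc σ σ, hσσ] using add_pos_of_nonneg_of_pos hz hs

theorem tendsto_norm_lineExp_shift (hE : IsCompact E) (hσ : |σ| = 1) (hz : 0 ≤ σ * z.im)
    (hzE : z ∉ ((↑) : ℝ → ℂ) '' E) :
    Tendsto (fun s : ℝ => ‖lineExp E σ (z + (σ * s : ℝ) * Complex.I)‖) (𝓝 0)
      (𝓝 (Real.exp (∫ t : ℝ in E, linePoisson z t))) := by
  have hpath : Continuous fun s : ℝ => z + (σ * s : ℝ) * Complex.I := by fun_prop
  have hlim := hpath.tendsto 0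
  simp only [mul_zero, Complex.ofReal_zero, zero_mul, add_zero] at hlim
  rw [← norm_lineExp hE hσ hz hzE]
  exact ((differentiableAt_lineExp hE σ hzE).continuousAt.tendsto.comp hlim).norm

end LineCauchy

theorem measurableEmbedding_ofReal : MeasurableEmbedding ((↑) : ℝ → ℂ) :=
  Complex.isometry_ofReal.isClosedEmbedding.measurableEmbedding

namespace IsHalfPlaneDomain

variable {G : Set ℂ} {σ : ℝ} {a : ℂ} {μ : Measure ℂ}

/-- The maximum principle for the function `lineExp E σ`, which has modulus at most `exp C` at
almost every boundary point; the translates make it continuous up to the boundary. -/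
theorem setIntegral_linePoisson_le (hG : IsHalfPlaneDomain σ G) (ha : a ∈ G)
    (hμ : IsHarmonicMeasure G a μ) {E : Set ℝ} (hE : IsCompact E)
    (hμE : μ (((↑) : ℝ → ℂ) '' E) = 0) {C : ℝ} (hC : 0 ≤ C)
    (hEC : ∀ ζ ∈ frontier G, ζ.im ≠ 0 → ∫ t : ℝ in E, linePoisson ζ t ≤ C) {z : ℂ} (hz : z ∈ G) :
    ∫ t : ℝ in E, linePoisson z t ≤ C := by
  have hσ := hG.abs_eq_one
  have hs : Tendsto (fun n : ℕ => 1 / ((n : ℝ) + 1)) atTop (𝓝 0) :=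
    tendsto_one_div_add_atTop_nhds_zero_nat
  have hshift : ∀ n : ℕ, ∀ w ∈ closure G,
      0 < σ * (w + (σ * (1 / ((n : ℝ) + 1)) : ℝ) * Complex.I).im := fun n w hw =>
    mul_im_shift_pos hσ (mul_im_nonneg_of_mem_closure hG.subset_halfPlane hw)
      Nat.one_div_pos_of_nat
  refine Real.exp_le_exp.1 (hμ.le_of_tendsto_norm hG.isOpen hG.isBounded hG.isPreconnected ha hz
    (q := fun n w => lineExp E σ (w + (σ * (1 / ((n : ℝ) + 1)) : ℝ) * Complex.I)) (fun n => ?_)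
    (B := Real.exp Real.pi) (fun n ζ hζ => ?_)
    (g := fun ζ => Real.exp (∫ t : ℝ in E, linePoisson ζ t)) ?_ ?_
    ((tendsto_norm_lineExp_shift hE hσ (hG.subset_halfPlane hz).le
      (notMem_image_ofReal (hG.subset_halfPlane hz))).comp hs))
  · refine DifferentiableOn.diffContOnCl fun w hw => DifferentiableAt.differentiableWithinAt ?_
    exact (differentiableAt_lineExp hE σ (notMem_image_ofReal (hshift n w hw))).comp
      (f := fun w => w + (σ * (1 / ((n : ℝ) + 1)) : ℝ) * Complex.I) w (by fun_prop)
  · have hpos := hshift n ζ (frontier_subset_closure hζ)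
    rw [norm_lineExp hE hσ hpos.le (notMem_image_ofReal hpos)]
    exact Real.exp_le_exp.2 (setIntegral_linePoisson_le_pi _ E)
  · filter_upwards [hμ.ae_mem_frontier, measure_eq_zero_iff_ae_notMem.1 hμE] with ζ hζ hζE
    exact (tendsto_norm_lineExp_shift hE hσ
      (mul_im_nonneg_of_mem_closure hG.subset_halfPlane hζ.1) hζE).comp hs
  · filter_upwards [hμ.ae_mem_frontier] with ζ hζ
    rcases eq_or_ne ζ.im 0 with h | h
    · simpa [linePoisson, h] using hC
    · exact Real.exp_le_exp.2 (hEC ζ hζ h)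

theorem restrict_absolutelyContinuous_comap (hG : IsHalfPlaneDomain σ G) (ha : a ∈ G)
    (hμ : IsHarmonicMeasure G a μ) {F : Set ℝ} (hF : MeasurableSet F)
    (hcone : ∀ᵐ x : ℝ, x ∈ F → IsConePoint G σ x) {C : ℝ} (hC : 0 ≤ C) (hCπ : C < Real.pi)
    (hFC : ∀ ζ ∈ frontier G, ζ.im ≠ 0 → ∫ t : ℝ in F, linePoisson ζ t ≤ C) :
    volume.restrict F ≪ μ.comap ((↑) : ℝ → ℂ) := by
  refine Measure.AbsolutelyContinuous.mk fun B hB hμB => ?_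
  rw [measurableEmbedding_ofReal.comap_apply] at hμB
  rw [Measure.restrict_apply hB]
  by_contra hne
  obtain ⟨E, hEBF, hE, hE0⟩ := (hB.inter hF).exists_lt_isCompact (pos_iff_ne_zero.2 hne)
  have hle : ∀ z ∈ G, ∫ t : ℝ in E, linePoisson z t ≤ C := fun z hz =>
    hG.setIntegral_linePoisson_le ha hμ hE
      (measure_mono_null (image_mono (hEBF.trans inter_subset_left)) hμB) hC
      (fun ζ hζ him => (setIntegral_linePoisson_mono ζ
        (hEBF.trans inter_subset_right).eventuallyLE).trans (hFC ζ hζ him)) hz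
  refine hE0.ne' (measure_eq_zero_iff_ae_notMem.2 ?_)
  filter_upwards [hcone, ae_hasLinearDensityAt_restrict_compl hE.measurableSet] with x hxc hxd hxE
  have := neBot_nhdsWithin_sideCone (x := x) hG.abs_eq_one one_pos
  refine (le_of_tendsto (tendsto_setIntegral_linePoisson hG.abs_eq_one one_pos hE.measurableSet
    (hxd hxE)) ?_).not_gt hCπ
  exact (hxc (hEBF hxE).2 1 one_pos).mono hle

end IsHalfPlaneDomain

theorem IsBeads.setIntegral_linePoisson_frontier_le {K : Set ℂ} {c r : ℕ → ℝ} (h : IsBeads K c r)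
    {σ : ℝ} {ζ : ℂ} (hζ : ζ ∈ frontier (sidePart K σ)) (him : ζ.im ≠ 0) :
    ∫ t : ℝ in {x : ℝ | (x : ℂ) ∈ K}, linePoisson ζ t ≤ Real.pi / 2 := by
  rcases h.norm_eq_one_or_eq_radius_of_mem_frontier hζ him with h1 | ⟨n, hn⟩
  · refine setIntegral_linePoisson_le_of_subset him (c := 0) (ρ := 1) (by simpa using h1) ?_
    intro x hx
    simpa [abs_le] using (h.mem_iff.1 hx).1
  · refine setIntegral_linePoisson_le_of_disjoint him hn (Set.disjoint_left.2 fun x hx hx' => ?_)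
    have hfar := (h.mem_iff.1 hx).2 n
    rw [← Complex.ofReal_sub, Complex.norm_real, Real.norm_eq_abs] at hfar
    rw [← Real.ball_eq_Ioo, mem_ball, Real.dist_eq] at hx'
    exact hx'.not_ge hfar

theorem IsBeads.restrict_absolutelyContinuous_comap {K : Set ℂ} {c r : ℕ → ℝ} (h : IsBeads K c r)
    {σ : ℝ} (hσ : |σ| = 1) {a : ℂ} (ha : a ∈ sidePart K σ) {μ : Measure ℂ}
    (hμ : IsHarmonicMeasure (sidePart K σ) a μ) :
    volume.restrict {x : ℝ | (x : ℂ) ∈ K} ≪ μ.comap ((↑) : ℝ → ℂ) :=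
  (h.isHalfPlaneDomain_sidePart hσ).restrict_absolutelyContinuous_comap ha hμ
    (h.isCompact.measurableSet.preimage Complex.measurable_ofReal) (h.ae_isConePoint_sidePart hσ)
    Real.pi_div_two_pos.le (half_lt_self Real.pi_pos)
    fun _ hζ him => h.setIntegral_linePoisson_frontier_le hζ him

/-! ### Differentiation of measures along the real line -/

/-- The real line in the plane. -/
def realLine : Set ℂ := range ((↑) : ℝ → ℂ)

theorem measurableSet_realLine : MeasurableSet realLine :=
  measurableEmbedding_ofReal.measurableSet_range

/-- Near `x ∈ ℝ` the measure `μ` is comparable to length on the real line: `μ` and its restriction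
to the line have the same positive and finite density at `x`. -/
def IsRegularAt (μ : Measure ℂ) (x : ℝ) : Prop :=
  ∃ D, D ≠ 0 ∧ D ≠ ∞ ∧ HasLinearDensityAt (μ.restrict realLine) (x : ℂ) D ∧
    HasLinearDensityAt μ (x : ℂ) D

theorem ae_comap_ofReal {μ : Measure ℂ} {P : ℂ → Prop} (h : ∀ᵐ ζ ∂μ, P ζ) :
    ∀ᵐ x : ℝ ∂μ.comap ((↑) : ℝ → ℂ), P x := by
  refine measurableEmbedding_ofReal.ae_map_iff.1 ?_
  rw [measurableEmbedding_ofReal.map_comap]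
  exact ae_restrict_of_ae h

theorem hasLinearDensityAt_restrict_realLine_iff {μ : Measure ℂ} {x : ℝ} {D : ℝ≥0∞} :
    HasLinearDensityAt (μ.restrict realLine) (x : ℂ) D ↔
      HasLinearDensityAt (μ.comap ((↑) : ℝ → ℂ)) x D := by
  rw [realLine, ← measurableEmbedding_ofReal.map_comap]
  unfold HasLinearDensityAt
  simp only [measurableEmbedding_ofReal.map_apply, Complex.isometry_ofReal.preimage_closedBall]

theorem ae_rnDeriv_ne_zero_of_restrict_absolutelyContinuous {α : Type*} [MeasurableSpace α]
    {μ ν : Measure α} [SigmaFinite μ] [SigmaFinite ν] {s : Set α} (hs : MeasurableSet s)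
    (h : μ.restrict s ≪ ν) : ∀ᵐ x ∂μ, x ∈ s → ν.rnDeriv μ x ≠ 0 := by
  filter_upwards [Measure.rnDeriv_mul_rnDeriv (κ := μ) h, Measure.rnDeriv_restrict_self μ hs]
    with x hmul hself hx hzero
  simp [hself, hx, hzero] at hmul

theorem HasLinearDensityAt.of_restrict {X : Type*} [PseudoMetricSpace X] [MeasurableSpace X]
    [OpensMeasurableSpace X] {ν : Measure X} [IsFiniteMeasure ν] {A : Set X} {x : X} {D : ℝ≥0∞}
    (h : HasLinearDensityAt (ν.restrict A) x D)
    (hA : Tendsto (fun s => ν (A ∩ closedBall x s) / ν (closedBall x s)) (𝓝[>] 0) (𝓝 1)) :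
    HasLinearDensityAt ν x D := by
  have hmul := ENNReal.Tendsto.mul (tendsto_inv_iff.2 hA) (Or.inl (by simp)) h (Or.inr (by simp))
  rw [inv_one, one_mul] at hmul
  refine hmul.congr' ?_
  filter_upwards [hA.eventually_ne one_ne_zero] with s hs
  have hpos := (ENNReal.div_ne_zero.1 hs).1
  rw [Measure.restrict_apply measurableSet_closedBall, inter_comm _ A,
    ENNReal.inv_div (Or.inl (measure_ne_top ν _)) (Or.inr hpos), ← mul_div_assoc,
    ENNReal.div_mul_cancel hpos (measure_ne_top ν _)]

theorem ae_isRegularAt {μ : Measure ℂ} [IsFiniteMeasure μ] {F : Set ℝ} (hF : MeasurableSet F)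
    (hac : volume.restrict F ≪ μ.comap ((↑) : ℝ → ℂ)) : ∀ᵐ x, x ∈ F → IsRegularAt μ x := by
  set ρ := μ.comap ((↑) : ℝ → ℂ)
  have hline := (ae_restrict_iff' hF).1 (hac.ae_le (ae_comap_ofReal
    (Besicovitch.ae_tendsto_measure_inter_div_of_measurableSet μ measurableSet_realLine)))
  filter_upwards [hline, ae_hasLinearDensityAt ρ, Measure.rnDeriv_ne_top ρ volume,
    ae_rnDeriv_ne_zero_of_restrict_absolutelyContinuous hF hac] with x hx hD htop hne hxF
  have hx := hx hxF
  rw [realLine, indicator_of_mem (mem_range_self x), Pi.one_apply] at hx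
  have hD := hasLinearDensityAt_restrict_realLine_iff.2 hD
  exact ⟨_, mul_ne_zero two_ne_zero (hne hxF), ENNReal.mul_ne_top ENNReal.ofNat_ne_top htop, hD,
    hD.of_restrict hx⟩

theorem ae_hasLinearDensityAt_withDensity_sub {E : Type*} [NormedAddCommGroup E]
    {μ : Measure ℂ} [IsFiniteMeasure μ] {F : Set ℝ} (hF : MeasurableSet F)
    (hac : volume.restrict F ≪ μ.comap ((↑) : ℝ → ℂ)) {h : ℂ → E} (hh : Integrable h μ) :
    ∀ᵐ x : ℝ, x ∈ F → HasLinearDensityAt (μ.withDensity fun ζ => ‖h ζ - h x‖ₑ) (x : ℂ) 0 := by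
  have hleb : ∀ᵐ x : ℝ, x ∈ F → Tendsto (fun a => (∫⁻ ζ in a, ‖h ζ - h x‖ₑ ∂μ) / μ a)
      ((Besicovitch.vitaliFamily μ).filterAt (x : ℂ)) (𝓝 0) :=
    (ae_restrict_iff' hF).1 (hac.ae_le (ae_comap_ofReal
      ((Besicovitch.vitaliFamily μ).ae_tendsto_lintegral_enorm_sub_div hh.locallyIntegrable)))
  filter_upwards [hleb, ae_isRegularAt hF hac] with x hx hreg hxF
  obtain ⟨D, hD0, hD, -, hDμ⟩ := hreg hxF
  have hmul := ENNReal.Tendsto.mul ((hx hxF).comp (Besicovitch.tendsto_filterAt μ (x : ℂ)))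
    (Or.inr hD) hDμ (Or.inr ENNReal.zero_ne_top)
  rw [zero_mul] at hmul
  refine hmul.congr' ?_
  filter_upwards [hDμ.eventually_ne hD0] with s hs
  rw [Function.comp_apply, withDensity_apply _ measurableSet_closedBall, ← mul_div_assoc,
    ENNReal.div_mul_cancel (ENNReal.div_ne_zero.1 hs).1 (measure_ne_top μ _)]

/-! ### Boundary behaviour in cones -/

theorem IsConePoint.eventually_ball_subset {G : Set ℂ} {σ x : ℝ} (hx : IsConePoint G σ x)
    (hσ : |σ| = 1) {α : ℝ} (hα : 0 < α) :
    ∀ᶠ z in 𝓝[sideCone σ α x] (x : ℂ), ball z (σ * z.im / 2) ⊆ G := by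
  obtain ⟨ε, hε, hsub⟩ := Metric.mem_nhdsWithin_iff.1 (hx (2 * α + 1) (by positivity))
  filter_upwards [self_mem_nhdsWithin, nhdsWithin_le_nhds (ball_mem_nhds _ (half_pos hε))]
    with z (hz : |z.re - x| < α * (σ * z.im)) hzε w hw
  have hy := mul_im_eq_abs_im hσ (sideCone_subset_halfPlane hα σ x hz).le
  rw [mem_ball, dist_eq_norm] at hw hzε
  have hre := (Complex.abs_re_le_norm (w - z)).trans_lt hw
  have him := (Complex.abs_im_le_norm (w - z)).trans_lt hw
  have hzx := Complex.abs_im_le_norm (z - x)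
  have hσim : |σ * (w - z).im| = |(w - z).im| := by rw [abs_mul, hσ, one_mul]
  rw [Complex.sub_im, Complex.ofReal_im, sub_zero, ← hy] at hzx
  rw [← hσim, Complex.sub_im, mul_sub, abs_sub_lt_iff] at him
  refine hsub ⟨?_, ?_⟩
  · have := norm_sub_le_norm_sub_add_norm_sub w z x
    rw [mem_ball, dist_eq_norm]
    linarith
  · have := abs_sub_le w.re z.re x
    rw [Complex.sub_re] at hre
    change |w.re - x| < (2 * α + 1) * (σ * w.im)
    nlinarith

section ReflectedKernel

variable {σ : ℝ} {z ζ : ℂ}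

theorem norm_sub_le_norm_sub_conj (hσ : |σ| = 1) (hz : 0 ≤ σ * z.im) (hζ : 0 ≤ σ * ζ.im) :
    ‖ζ - z‖ ≤ ‖ζ - starRingEnd ℂ z‖ := by
  have him : 0 ≤ z.im * ζ.im := by
    have := mul_nonneg hz hζ
    rwa [mul_mul_mul_comm, ← abs_mul_abs_self, hσ, one_mul, one_mul] at this
  refine le_of_sq_le_sq ?_ (norm_nonneg _)
  rw [norm_sq_eq_re_sq_add_im_sq, norm_sq_eq_re_sq_add_im_sq]
  simp only [Complex.sub_re, Complex.sub_im, Complex.conj_re, Complex.conj_im]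
  linarith

theorem norm_reflectedKernel_le (hσ : |σ| = 1) (hz : 0 ≤ σ * z.im) (hζ : 0 ≤ σ * ζ.im)
    (hne : ζ ≠ z) : ‖reflectedKernel z ζ‖ ≤ 2 * linePoisson z ζ := by
  have hle := norm_sub_le_norm_sub_conj hσ hz hζ
  have hpos : 0 < ‖ζ - z‖ := norm_pos_iff.2 (sub_ne_zero.2 hne)
  have hnum : ‖ζ - starRingEnd ℂ z - (ζ - z)‖ = 2 * |z.im| := by
    rw [sub_sub_sub_cancel_left, Complex.sub_conj]
    simp
  rw [reflectedKernel, inv_sub_inv (norm_pos_iff.1 hpos) (norm_pos_iff.1 (hpos.trans_le hle)),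
    norm_div, hnum, norm_mul, linePoisson, sq, mul_div_assoc]
  gcongr

theorem norm_reflectedKernel_le_radialKernel {α x : ℝ} (hσ : |σ| = 1) (hα : 0 < α)
    (hz : z ∈ sideCone σ α x) (hζ : 0 ≤ σ * ζ.im) (hdist : σ * z.im / 2 ≤ ‖ζ - z‖) :
    ‖reflectedKernel z ζ‖ ≤ 2 * (2 * α + 5) ^ 2 * radialKernel (x : ℂ) (σ * z.im) ζ := by
  have hy : 0 < σ * z.im := sideCone_subset_halfPlane hα σ x hz
  have hne : ζ ≠ z := by
    rintro rfl
    simp only [sub_self, norm_zero] at hdist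
    linarith
  calc ‖reflectedKernel z ζ‖ ≤ 2 * linePoisson z ζ := norm_reflectedKernel_le hσ hy.le hζ hne
    _ ≤ 2 * ((2 * α + 5) ^ 2 * radialKernel (x : ℂ) (σ * z.im) ζ) := by
      gcongr
      exact linePoisson_le_radialKernel hσ hα hz hdist
    _ = _ := (mul_assoc _ _ _).symm

theorem reflectedKernel_of_mem_realLine (hz : z.im ≠ 0) (hζ : ζ ∈ realLine) :
    reflectedKernel z ζ = ((2 * z.im / ‖ζ - z‖ ^ 2 : ℝ) : ℂ) * Complex.I := by
  obtain ⟨t, rfl⟩ := hζ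
  have hne : (t : ℂ) - z ≠ 0 := fun h => hz (by simpa using congrArg Complex.im h)
  have hconj : (t : ℂ) - starRingEnd ℂ z = starRingEnd ℂ (t - z) := by simp
  have hne' : (t : ℂ) - starRingEnd ℂ z ≠ 0 := by rwa [hconj, map_ne_zero]
  rw [reflectedKernel, inv_sub_inv hne hne', sub_sub_sub_cancel_left, Complex.sub_conj, hconj,
    Complex.mul_conj']
  push_cast
  ring

theorem norm_setIntegral_realLine_reflectedKernel (μ : Measure ℂ) (hz : z.im ≠ 0) :
    ‖∫ ζ in realLine, reflectedKernel z ζ ∂μ‖ = 2 * ∫ ζ in realLine, linePoisson z ζ ∂μ := by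
  have hcongr : ∫ ζ in realLine, reflectedKernel z ζ ∂μ =
      ((∫ ζ in realLine, 2 * z.im / ‖ζ - z‖ ^ 2 ∂μ : ℝ) : ℂ) * Complex.I := by
    rw [← integral_complex_ofReal, ← integral_mul_const]
    exact setIntegral_congr_fun measurableSet_realLine
      fun ζ hζ => reflectedKernel_of_mem_realLine hz hζ
  rw [hcongr, norm_mul, Complex.norm_I, mul_one, Complex.norm_real, Real.norm_eq_abs]
  simp only [linePoisson, div_eq_mul_inv, integral_const_mul, abs_mul]
  rw [abs_two, mul_assoc, abs_of_nonneg (integral_nonneg fun ζ => by positivity)]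

end ReflectedKernel

theorem linePoisson_le_inv_of_mem_realLine {z ζ : ℂ} (hζ : ζ ∈ realLine) :
    linePoisson z ζ ≤ |z.im|⁻¹ := by
  obtain ⟨t, rfl⟩ := hζ
  rw [linePoisson_ofReal]
  exact mul_le_of_le_one_right (by positivity)
    (inv_le_one_of_one_le₀ (le_add_of_nonneg_right (sq_nonneg _)))

theorem integrable_linePoisson_of_ae_mem_realLine (z : ℂ) {ν : Measure ℂ} [IsFiniteMeasure ν]
    (hline : ∀ᵐ ζ ∂ν, ζ ∈ realLine) : Integrable (linePoisson z) ν := by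
  have hmeas : Measurable (linePoisson z) := by
    unfold linePoisson
    fun_prop
  refine .of_bound hmeas.aestronglyMeasurable |z.im|⁻¹ (hline.mono fun ζ hζ => ?_)
  rw [Real.norm_of_nonneg (linePoisson_nonneg z ζ)]
  exact linePoisson_le_inv_of_mem_realLine hζ

theorem inv_le_linePoisson {σ α x : ℝ} (hσ : |σ| = 1) (hα : 0 < α) {z ζ : ℂ}
    (hz : z ∈ sideCone σ α x) (hne : ζ ≠ z) (hζ : ζ ∈ closedBall (x : ℂ) (σ * z.im)) :
    ((α + 2) ^ 2 * (σ * z.im))⁻¹ ≤ linePoisson z ζ := by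
  have hy : 0 < σ * z.im := sideCone_subset_halfPlane hα σ x hz
  have hpos : 0 < ‖ζ - z‖ := norm_pos_iff.2 (sub_ne_zero.2 hne)
  have hle : ‖ζ - z‖ ≤ (α + 2) * (σ * z.im) := by
    have htri := norm_sub_le_norm_sub_add_norm_sub ζ x z
    have hzx := norm_sub_ofReal_le_of_mem_sideCone hσ hα hz
    rw [mem_closedBall, dist_eq_norm] at hζ
    rw [norm_sub_rev (x : ℂ)] at htri
    linarith
  calc ((α + 2) ^ 2 * (σ * z.im))⁻¹ = σ * z.im / ((α + 2) * (σ * z.im)) ^ 2 := by field_simp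
    _ ≤ linePoisson z ζ := by
      rw [linePoisson, ← mul_im_eq_abs_im hσ hy.le]
      gcongr

theorem exists_le_integral_linePoisson {σ α x : ℝ} (hσ : |σ| = 1) (hα : 0 < α) {ν : Measure ℂ}
    [IsFiniteMeasure ν] (hline : ∀ᵐ ζ ∂ν, ζ ∈ realLine) {D : ℝ≥0∞} (hD : D ≠ 0)
    (h : HasLinearDensityAt ν (x : ℂ) D) :
    ∃ κ > 0, ∀ᶠ z in 𝓝[sideCone σ α x] (x : ℂ), κ ≤ ∫ ζ, linePoisson z ζ ∂ν := by
  obtain ⟨d, hd0, hd⟩ := exists_between (pos_iff_ne_zero.2 hD)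
  have hdtop := hd.ne_top
  refine ⟨((α + 2) ^ 2)⁻¹ * d.toReal,
    mul_pos (by positivity) (ENNReal.toReal_pos hd0.ne' hdtop), ?_⟩
  filter_upwards [self_mem_nhdsWithin,
    (h.comp (tendsto_mul_im_sideCone (σ := σ) hα)).eventually_const_le hd] with z hz hdz
  have hy : 0 < σ * z.im := sideCone_subset_halfPlane hα σ x hz
  have him : z.im ≠ 0 := right_ne_zero_of_mul hy.ne'
  have hreal : d.toReal * (σ * z.im) ≤ ν.real (closedBall (x : ℂ) (σ * z.im)) := by
    have := ENNReal.toReal_mono (measure_ne_top ν _) ((ENNReal.le_div_iff_mul_le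
      (Or.inl (by simpa using hy)) (Or.inl ENNReal.ofReal_ne_top)).1 hdz)
    rwa [ENNReal.toReal_mul, ENNReal.toReal_ofReal hy.le] at this
  have hint := integrable_linePoisson_of_ae_mem_realLine z hline
  calc ((α + 2) ^ 2)⁻¹ * d.toReal
      = ((α + 2) ^ 2 * (σ * z.im))⁻¹ * (d.toReal * (σ * z.im)) := by
        rw [mul_inv, mul_mul_mul_comm, inv_mul_cancel₀ hy.ne', mul_one]
    _ ≤ ((α + 2) ^ 2 * (σ * z.im))⁻¹ * ν.real (closedBall (x : ℂ) (σ * z.im)) := by gcongr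
    _ = ∫ _ in closedBall (x : ℂ) (σ * z.im), ((α + 2) ^ 2 * (σ * z.im))⁻¹ ∂ν := by
      rw [setIntegral_const, smul_eq_mul, mul_comm]
    _ ≤ ∫ ζ in closedBall (x : ℂ) (σ * z.im), linePoisson z ζ ∂ν := by
      refine setIntegral_mono_on_ae (integrable_const _).integrableOn hint.integrableOn
        measurableSet_closedBall (hline.mono fun ζ hζ hζx => ?_)
      refine inv_le_linePoisson hσ hα hz ?_ hζx
      rintro rfl
      obtain ⟨t, rfl⟩ := hζ
      exact him (Complex.ofReal_im t)
    _ ≤ ∫ ζ, linePoisson z ζ ∂ν :=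
      setIntegral_le_integral hint (ae_of_all _ (linePoisson_nonneg z))

theorem HasLinearDensityAt.restrict_compl {X : Type*} [PseudoMetricSpace X] [MeasurableSpace X]
    {ν : Measure X} [IsFiniteMeasure ν] {A : Set X} {x : X} {D : ℝ≥0∞}
    (hA : MeasurableSet A) (h : HasLinearDensityAt ν x D)
    (hνA : HasLinearDensityAt (ν.restrict A) x D) (hD : D ≠ ∞) :
    HasLinearDensityAt (ν.restrict Aᶜ) x 0 := by
  have hsub := ENNReal.Tendsto.sub h hνA (Or.inl hD)
  rw [tsub_self] at hsub
  refine hsub.congr' ?_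
  filter_upwards [self_mem_nhdsWithin] with s (hs : 0 < s)
  rw [← ENNReal.sub_div fun _ _ => by simpa using hs,
    ENNReal.sub_eq_of_eq_add_rev (measure_ne_top _ _) ?_]
  rw [← Measure.add_apply, Measure.restrict_add_restrict_compl hA]

theorem IsHarmonicMeasure.integrable_sub_const {G : Set ℂ} {a : ℂ} {μ : Measure ℂ}
    (hμ : IsHarmonicMeasure G a μ) (hb : Bornology.IsBounded G) (c : ℂ) :
    Integrable (fun ζ => ζ - c) μ :=
  hμ.integrable_of_continuousOn hb (continuous_sub_right c).continuousOn

theorem IsHarmonicMeasure.integrable_mul_sub_const {G : Set ℂ} {a : ℂ} {μ ω : Measure ℂ}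
    (hμ : IsHarmonicMeasure G a μ) (hb : Bornology.IsBounded G) (hle : μ ≤ ω) (c : ℂ) {t : ℝ≥0∞}
    [ht : Fact (1 ≤ t)] (f : Lp ℂ t ω) : Integrable (fun ζ => f ζ * (ζ - c)) μ := by
  have := hμ.isProbabilityMeasure
  obtain ⟨C, hC⟩ := (isCompact_frontier hb).exists_bound_of_continuousOn
    (continuous_sub_right c).continuousOn
  exact (((Lp.memLp f).mono_measure hle).integrable ht.out).mul_bdd
    (hμ.integrable_sub_const hb c).1 (hμ.ae_mem_frontier.mono hC)

namespace IsHalfPlaneDomain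

variable {σ α x : ℝ} {G : Set ℂ} {μ : Measure ℂ}

theorem tendsto_integral_mul_reflectedKernel_zero (hG : IsHalfPlaneDomain σ G)
    (hx : IsConePoint G σ x) (hα : 0 < α) (hμ : ∀ᵐ ζ ∂μ, ζ ∈ frontier G) {g : ℂ → ℂ}
    (hg : Integrable g μ) (h : HasLinearDensityAt (μ.withDensity (‖g ·‖ₑ)) (x : ℂ) 0) :
    Tendsto (fun z => ∫ ζ, g ζ * reflectedKernel z ζ ∂μ) (𝓝[sideCone σ α x] (x : ℂ)) (𝓝 0) := by
  have hσ := hG.abs_eq_one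
  have := isFiniteMeasure_withDensity hg.2.ne
  obtain ⟨B, hB, hgrowth⟩ := h.exists_measure_closedBall_le ENNReal.zero_ne_top
  refine tendsto_integral_of_enorm_le_radialKernel hg.1.enorm h hB hgrowth
    (tendsto_mul_im_sideCone hα) (C := ENNReal.ofReal (2 * (2 * α + 5) ^ 2))
    ENNReal.ofReal_ne_top ?_
  filter_upwards [self_mem_nhdsWithin, hx.eventually_ball_subset hσ hα] with z hz hball
  filter_upwards [hμ] with ζ hζ
  have hdist : σ * z.im / 2 ≤ ‖ζ - z‖ := by
    by_contra! hlt
    rw [← dist_eq_norm] at hlt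
    exact notMem_frontier_of_mem hG.isOpen (hball hlt) hζ
  have hle := norm_reflectedKernel_le_radialKernel hσ hα hz
    (mul_im_nonneg_of_mem_closure hG.subset_halfPlane (frontier_subset_closure hζ)) hdist
  rw [enorm_mul, mul_left_comm, ← ENNReal.ofReal_mul (by positivity),
    ← ofReal_norm (reflectedKernel z ζ)]
  gcongr

theorem exists_le_norm_integral_reflectedKernel [IsFiniteMeasure μ] (hG : IsHalfPlaneDomain σ G)
    (hx : IsConePoint G σ x) (hα : 0 < α) (hμ : ∀ᵐ ζ ∂μ, ζ ∈ frontier G)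
    (hreg : IsRegularAt μ x) :
    ∃ κ > 0, ∀ᶠ z in 𝓝[sideCone σ α x] (x : ℂ), κ ≤ ‖∫ ζ, reflectedKernel z ζ ∂μ‖ := by
  obtain ⟨D, hD0, hD, hline, hplane⟩ := hreg
  obtain ⟨κ, hκ, hlower⟩ := exists_le_integral_linePoisson hG.abs_eq_one hα
    (ae_restrict_mem measurableSet_realLine) hD0 hline
  have hoff : Tendsto (fun z => ∫ ζ in realLineᶜ, reflectedKernel z ζ ∂μ)
      (𝓝[sideCone σ α x] (x : ℂ)) (𝓝 0) := by
    simpa using hG.tendsto_integral_mul_reflectedKernel_zero hx hα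
      (μ := μ.restrict realLineᶜ) (ae_restrict_of_ae hμ) (integrable_const 1)
      (by simpa using hplane.restrict_compl measurableSet_realLine hline hD)
  refine ⟨κ, hκ, ?_⟩
  filter_upwards [self_mem_nhdsWithin, hlower, hx α hα,
    hoff.norm.eventually_le_const (by simpa using hκ)] with z hz hκz hzG hoffz
  have him : z.im ≠ 0 := right_ne_zero_of_mul (sideCone_subset_halfPlane hα σ x hz).ne'
  have hint : Integrable (reflectedKernel z) μ := by
    simpa using hG.integrable_mul_reflectedKernel hzG hμ (integrable_const 1)
  rw [← integral_add_compl measurableSet_realLine hint]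
  calc κ ≤ 2 * (∫ ζ in realLine, linePoisson z ζ ∂μ) - κ := by linarith
    _ ≤ ‖∫ ζ in realLine, reflectedKernel z ζ ∂μ‖ - ‖∫ ζ in realLineᶜ, reflectedKernel z ζ ∂μ‖ := by
      rw [norm_setIntegral_realLine_reflectedKernel μ him]
      gcongr
    _ ≤ _ := norm_sub_le_norm_add _ _

theorem tendsto_integral_mul_reflectedKernel_div [IsFiniteMeasure μ] (hG : IsHalfPlaneDomain σ G)
    (hx : IsConePoint G σ x) (hα : 0 < α) (hμ : ∀ᵐ ζ ∂μ, ζ ∈ frontier G)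
    (hreg : IsRegularAt μ x) {g : ℂ → ℂ} (hg : Integrable g μ)
    (h : HasLinearDensityAt (μ.withDensity fun ζ => ‖g ζ - g x‖ₑ) (x : ℂ) 0) :
    Tendsto (fun z => (∫ ζ, g ζ * reflectedKernel z ζ ∂μ) / ∫ ζ, reflectedKernel z ζ ∂μ)
      (𝓝[sideCone σ α x] (x : ℂ)) (𝓝 (g x)) := by
  obtain ⟨κ, hκ, hlower⟩ := hG.exists_le_norm_integral_reflectedKernel hx hα hμ hreg
  have hdiff := (hG.tendsto_integral_mul_reflectedKernel_zero hx hα hμ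
    (hg.sub (integrable_const (g x))) h).norm.div_const κ
  rw [norm_zero, zero_div] at hdiff
  refine tendsto_iff_norm_sub_tendsto_zero.2 (squeeze_zero' (Eventually.of_forall fun _ =>
    norm_nonneg _) ?_ hdiff)
  filter_upwards [hlower, hx α hα] with z hz hzG
  have hne := norm_pos_iff.1 (hκ.trans_le hz)
  have hsplit : ∫ ζ, (g ζ - g x) * reflectedKernel z ζ ∂μ =
      (∫ ζ, g ζ * reflectedKernel z ζ ∂μ) - g x * ∫ ζ, reflectedKernel z ζ ∂μ := by
    simp only [sub_mul]
    rw [integral_sub (hG.integrable_mul_reflectedKernel hzG hμ hg)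
      (hG.integrable_mul_reflectedKernel hzG hμ (integrable_const _)), integral_const_mul]
  rw [div_sub' hne, norm_div, mul_comm _ (g x), ← hsplit]
  exact div_le_div_of_nonneg_left (norm_nonneg _) hκ hz

theorem tendsto_evalMap {a : ℂ} {K : Set ℂ} {t : ℝ≥0∞} [Fact (1 ≤ t)] {ω : Measure ℂ}
    [IsFiniteMeasure ω] (hG : IsHalfPlaneDomain σ G) (ha : a ∈ G) (hμ : IsHarmonicMeasure G a μ)
    (hK : IsCompact K) (hGK : closure G ⊆ K) (hω : ∀ᵐ z ∂ω, z ∈ K) (hle : μ ≤ ω) {f : Lp ℂ t ω}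
    (hf : f ∈ rationalLp K t ω) (hx : IsConePoint G σ x) (hreg : IsRegularAt μ x)
    (hsub : HasLinearDensityAt (μ.withDensity fun ζ => ‖ζ - a - (x - a)‖ₑ) (x : ℂ) 0)
    (hmul : HasLinearDensityAt
      (μ.withDensity fun ζ => ‖f ζ * (ζ - a) - f x * (x - a)‖ₑ) (x : ℂ) 0)
    (hα : 0 < α) : Tendsto (evalMap K t ω f) (𝓝[sideCone σ α x] (x : ℂ)) (𝓝 (f x)) := by
  have := hμ.isProbabilityMeasure
  have hax : (x : ℂ) - a ≠ 0 := by
    have hpos : 0 < σ * a.im := hG.subset_halfPlane ha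
    refine sub_ne_zero.2 fun h => hpos.ne' ?_
    rw [← h, Complex.ofReal_im, mul_zero]
  have hweight := hG.tendsto_integral_mul_reflectedKernel_div hx hα hμ.ae_mem_frontier hreg
    (hμ.integrable_sub_const hG.isBounded a) hsub
  have hnum := hG.tendsto_integral_mul_reflectedKernel_div hx hα hμ.ae_mem_frontier hreg
    (hμ.integrable_mul_sub_const hG.isBounded hle a f) hmul
  have hquot := hnum.div hweight hax
  rw [mul_div_cancel_right₀ _ hax] at hquot
  refine hquot.congr' ?_
  filter_upwards [hx α hα, hweight.eventually_ne hax] with z hz hne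
  obtain ⟨hW, hI⟩ := div_ne_zero_iff.1 hne
  have hw : cauchyWeight μ a z ≠ 0 := by rwa [hG.cauchyWeight_eq hμ hz]
  rw [hG.evalMap_eq hμ hK hGK hω hle hz hw hf, hG.cauchyWeight_eq hμ hz, Pi.div_apply,
    div_div_div_cancel_right₀ hI]
  simp only [mul_assoc]

end IsHalfPlaneDomain

/-! ### String of beads sets: boundary values and irreducibility -/

namespace IsBeads

variable {K : Set ℂ} {c r : ℕ → ℝ} {σ : ℝ} {a : ℂ} {μ ω : Measure ℂ}

theorem ae_mem (h : IsBeads K c r) (hμ : IsHarmonicMeasure (sidePart K σ) a μ) :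
    ∀ᵐ z ∂μ, z ∈ K :=
  hμ.ae_mem_frontier.mono fun _ hz => h.closure_sidePart_subset σ (frontier_subset_closure hz)

theorem sidePart_subset_abpe (h : IsBeads K c r) (hσ : |σ| = 1) (ha : a ∈ sidePart K σ)
    (hμ : IsHarmonicMeasure (sidePart K σ) a μ) {t : ℝ≥0∞} [Fact (1 ≤ t)] [IsFiniteMeasure ω]
    (hω : ∀ᵐ z ∂ω, z ∈ K) (hle : μ ≤ ω) : sidePart K σ ⊆ abpe K t ω :=
  hμ.subset_abpe (isOpen_sidePart K σ) (h.isPreconnected_sidePart hσ) ha h.isCompact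
    (h.closure_sidePart_subset σ) hω hle

theorem ae_tendsto_evalMap (h : IsBeads K c r) (hσ : |σ| = 1) (ha : a ∈ sidePart K σ)
    (hμ : IsHarmonicMeasure (sidePart K σ) a μ) {t : ℝ≥0∞} [Fact (1 ≤ t)] [IsFiniteMeasure ω]
    (hω : ∀ᵐ z ∂ω, z ∈ K) (hle : μ ≤ ω) {f : Lp ℂ t ω} (hf : f ∈ rationalLp K t ω) :
    ∀ᵐ x : ℝ, (x : ℂ) ∈ K → ∀ α : ℝ, 0 < α →
      Tendsto (evalMap K t ω f) (𝓝[sideCone σ α x] (x : ℂ)) (𝓝 (f x)) := by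
  have := hμ.isProbabilityMeasure
  have hG := h.isHalfPlaneDomain_sidePart hσ
  have hF : MeasurableSet {x : ℝ | (x : ℂ) ∈ K} :=
    h.isCompact.measurableSet.preimage Complex.measurable_ofReal
  have hac := h.restrict_absolutelyContinuous_comap hσ ha hμ
  filter_upwards [h.ae_isConePoint_sidePart hσ, ae_isRegularAt hF hac,
    ae_hasLinearDensityAt_withDensity_sub hF hac (hμ.integrable_sub_const hG.isBounded a),
    ae_hasLinearDensityAt_withDensity_sub hF hac
      (hμ.integrable_mul_sub_const hG.isBounded hle a f)] with x hcone hreg hsub hmul hx α hα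
  exact hG.tendsto_evalMap ha hμ h.isCompact (h.closure_sidePart_subset σ) hω hle hf (hcone hx)
    (hreg hx) (hsub hx) (hmul hx) hα

/-- Length on `K ∩ ℝ` is absolutely continuous with respect to both harmonic measures, so these are
not mutually singular. -/
theorem not_measure_eq_zero_and_compl_eq_zero (h : IsBeads K c r)
    (hvol : 0 < volume {x : ℝ | (x : ℂ) ∈ K}) {τ : ℝ} {b : ℂ} {ν : Measure ℂ} (hσ : |σ| = 1)
    (hτ : |τ| = 1) (ha : a ∈ sidePart K σ) (hb : b ∈ sidePart K τ)
    (hμ : IsHarmonicMeasure (sidePart K σ) a μ) (hν : IsHarmonicMeasure (sidePart K τ) b ν)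
    (A : Set ℂ) : ¬(μ A = 0 ∧ ν Aᶜ = 0) := by
  rintro ⟨hA, hAc⟩
  have hnull : ∀ {ρ : Measure ℂ} {B : Set ℂ},
      volume.restrict {x : ℝ | (x : ℂ) ∈ K} ≪ ρ.comap ((↑) : ℝ → ℂ) → ρ B = 0 →
      volume.restrict {x : ℝ | (x : ℂ) ∈ K} (((↑) : ℝ → ℂ) ⁻¹' B) = 0 := fun hac hB =>
    hac <| by
      rw [measurableEmbedding_ofReal.comap_apply]
      exact measure_mono_null (image_preimage_subset _ _) hB
  have huniv := measure_union_null (hnull (h.restrict_absolutelyContinuous_comap hσ ha hμ) hA)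
    (hnull (h.restrict_absolutelyContinuous_comap hτ hb hν) hAc)
  rw [preimage_compl, union_compl_self, Measure.restrict_apply_univ] at huniv
  exact hvol.ne' huniv

theorem isIrreducibleMul_add (h : IsBeads K c r) (hvol : 0 < volume {x : ℝ | (x : ℂ) ∈ K})
    {τ : ℝ} {b : ℂ} {ν : Measure ℂ} (hσ : |σ| = 1) (hτ : |τ| = 1) (ha : a ∈ sidePart K σ)
    (hb : b ∈ sidePart K τ) (hμ : IsHarmonicMeasure (sidePart K σ) a μ)
    (hν : IsHarmonicMeasure (sidePart K τ) b ν) (t : ℝ≥0∞) [Fact (1 ≤ t)] :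
    IsIrreducibleMul K t (μ + ν) := by
  have := hμ.isProbabilityMeasure
  have := hν.isProbabilityMeasure
  have hω : ∀ᵐ z ∂(μ + ν), z ∈ K := ae_add_measure_iff.2 ⟨h.ae_mem hμ, h.ae_mem hν⟩
  rintro A hA ⟨f, hf, hfA⟩
  rcases hμ.measure_eq_zero_or_compl_eq_zero (isOpen_sidePart K σ) h.isCompact
      (h.closure_sidePart_subset σ) hω (Measure.le_add_right le_rfl) hA hf hfA with hμA | hμA <;>
    rcases hν.measure_eq_zero_or_compl_eq_zero (isOpen_sidePart K τ) h.isCompact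
      (h.closure_sidePart_subset τ) hω (Measure.le_add_left le_rfl) hA hf hfA with hνA | hνA
  · exact Or.inl (by simp [hμA, hνA])
  · exact absurd ⟨hμA, hνA⟩
      (h.not_measure_eq_zero_and_compl_eq_zero hvol hσ hτ ha hb hμ hν A)
  · exact absurd ⟨hνA, hμA⟩
      (h.not_measure_eq_zero_and_compl_eq_zero hvol hτ hσ hb ha hν hμ A)
  · exact Or.inr (by simp [hμA, hνA])

theorem interior_subset_abpe_add (h : IsBeads K c r) {b : ℂ} {ν : Measure ℂ}
    (ha : a ∈ sidePart K 1) (hb : b ∈ sidePart K (-1)) (hμ : IsHarmonicMeasure (sidePart K 1) a μ)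
    (hν : IsHarmonicMeasure (sidePart K (-1)) b ν) (t : ℝ≥0∞) [Fact (1 ≤ t)] :
    interior K ⊆ abpe K t (μ + ν) := by
  have := hμ.isProbabilityMeasure
  have := hν.isProbabilityMeasure
  have hω : ∀ᵐ z ∂(μ + ν), z ∈ K := ae_add_measure_iff.2 ⟨h.ae_mem hμ, h.ae_mem hν⟩
  intro z hz
  rcases (h.im_ne_zero hz).lt_or_gt with him | him
  · exact h.sidePart_subset_abpe (by simp) hb hν hω (Measure.le_add_left le_rfl)
      ⟨hz, by simpa [halfPlane] using him⟩
  · exact h.sidePart_subset_abpe (by simp) ha hμ hω (Measure.le_add_right le_rfl)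
      ⟨hz, by simpa [halfPlane] using him⟩

theorem ae_hasTopLimit_and_hasBottomLimit (h : IsBeads K c r) {b : ℂ} {ν : Measure ℂ}
    (ha : a ∈ sidePart K 1) (hb : b ∈ sidePart K (-1)) (hμ : IsHarmonicMeasure (sidePart K 1) a μ)
    (hν : IsHarmonicMeasure (sidePart K (-1)) b ν) {t : ℝ≥0∞} [Fact (1 ≤ t)] {f : Lp ℂ t (μ + ν)}
    (hf : f ∈ rationalLp K t (μ + ν)) : ∀ᵐ x : ℝ, (x : ℂ) ∈ K → ∀ α : ℝ, 0 < α →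
      HasTopLimit (interior K) (evalMap K t (μ + ν) f) x α (f x) ∧
      HasBottomLimit (interior K) (evalMap K t (μ + ν) f) x α (f x) := by
  have := hμ.isProbabilityMeasure
  have := hν.isProbabilityMeasure
  have hω : ∀ᵐ z ∂(μ + ν), z ∈ K := ae_add_measure_iff.2 ⟨h.ae_mem hμ, h.ae_mem hν⟩
  filter_upwards [h.ae_isConePoint_sidePart (σ := 1) (by simp),
    h.ae_isConePoint_sidePart (σ := -1) (by simp),
    h.ae_tendsto_evalMap (by simp) ha hμ hω (Measure.le_add_right le_rfl) hf,
    h.ae_tendsto_evalMap (by simp) hb hν hω (Measure.le_add_left le_rfl) hf]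
    with x htop hbot hlimtop hlimbot hx α hα
  exact ⟨hasTopLimit_of_tendsto ((htop hx α hα).mono fun _ hz => hz.1) (hlimtop hx α hα),
    hasBottomLimit_of_tendsto ((hbot hx α hα).mono fun _ hz => hz.1) (hlimbot hx α hα)⟩

theorem isHarmonicMeasure_sidePart (h : IsBeads K c r) (ha : a ∈ sidePart K σ) :
    IsHarmonicMeasure (sidePart K σ) a (harmonicMeasure (sidePart K σ) a) :=
  isHarmonicMeasure_harmonicMeasure (isOpen_sidePart K σ)
    (h.isCompact.isBounded.subset sidePart_subset) ha

end IsBeads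

theorem IsStringOfBeads.conj_mem_lowerPart {K : Set ℂ} (hK : IsStringOfBeads K) {z : ℂ}
    (hz : z ∈ upperPart K) : starRingEnd ℂ z ∈ lowerPart K := by
  obtain ⟨c, r, h⟩ := hK.exists_isBeads
  rw [h.lowerPart_eq_sidePart]
  exact h.conj_mem_sidePart_neg (upperPart_eq_sidePart K ▸ hz)

end MeanRational

end

theorem mainTheorem4_general (K : Set ℂ) (hK : MeanRational.IsStringOfBeads K) (t : ℝ≥0∞)
    [Fact (1 ≤ t)] {a b : ℂ} (ha : a ∈ MeanRational.upperPart K)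
    (hb : b ∈ MeanRational.lowerPart K) (ω : Measure ℂ)
    (hω : ω = MeanRational.harmonicMeasure (MeanRational.upperPart K) a +
      MeanRational.harmonicMeasure (MeanRational.lowerPart K) b) :
    interior K ⊆ MeanRational.abpe K t ω ∧
    (∀ f ∈ MeanRational.rationalLp K t ω, ∀ᵐ x : ℝ, (x : ℂ) ∈ MeanRational.innerBoundary K →
      ∀ α : ℝ, 0 < α →
        MeanRational.HasTopLimit (interior K) (MeanRational.evalMap K t ω f) x α (f x) ∧
        MeanRational.HasBottomLimit (interior K) (MeanRational.evalMap K t ω f) x α (f x)) ∧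
    MeanRational.IsIrreducibleMul K t ω := by
  obtain ⟨c, r, h⟩ := hK.exists_isBeads
  rw [MeanRational.upperPart_eq_sidePart, h.lowerPart_eq_sidePart] at hω
  rw [MeanRational.upperPart_eq_sidePart] at ha
  rw [h.lowerPart_eq_sidePart] at hb
  subst hω
  have hμ := h.isHarmonicMeasure_sidePart ha
  have hν := h.isHarmonicMeasure_sidePart hb
  refine ⟨h.interior_subset_abpe_add ha hb hμ hν t, fun f hf => ?_,
    h.isIrreducibleMul_add hK.volume_real_pos (by simp) (by simp) ha hb hμ hν t⟩
  filter_upwards [h.ae_hasTopLimit_and_hasBottomLimit ha hb hμ hν hf] with x hx hxK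
  exact hx (h.isCompact.isClosed.frontier_subset hxK.1)

theorem mainTheorem4 (K : Set ℂ) (hK : MeanRational.IsStringOfBeads K)
    (hI : Complex.I / 2 ∈ interior K) (ω : Measure ℂ)
    (hω : ω = MeanRational.harmonicMeasure (MeanRational.upperPart K) (Complex.I / 2) +
      MeanRational.harmonicMeasure (MeanRational.lowerPart K) (-(Complex.I / 2))) :
    interior K ⊆ MeanRational.abpe K 2 ω ∧
    (∀ f ∈ MeanRational.rationalLp K 2 ω, ∀ᵐ x : ℝ, (x : ℂ) ∈ MeanRational.innerBoundary K →
      ∀ α : ℝ, 0 < α → α ≤ 1 →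
        MeanRational.HasTopLimit (interior K) (MeanRational.evalMap K 2 ω f) x α (f x) ∧
        MeanRational.HasBottomLimit (interior K) (MeanRational.evalMap K 2 ω f) x α (f x)) ∧
    MeanRational.IsIrreducibleMul K 2 ω := by
  have hup : Complex.I / 2 ∈ MeanRational.upperPart K := ⟨hI, by simp⟩
  have hlow : -(Complex.I / 2) ∈ MeanRational.lowerPart K := by
    simpa [neg_div, Complex.conj_ofNat] using hK.conj_mem_lowerPart hup
  obtain ⟨habpe, hlim, hirr⟩ := mainTheorem4_general K hK 2 hup hlow ω hω
  exact ⟨habpe, fun f hf => (hlim f hf).mono fun x hx hxK α hα _ => hx hxK α hα, hirr⟩
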